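/- All knots are tame knots in $\mathbb{R}^3$, given as simple closed polygons and considered up to the usual (combinatorial, i.e. triangle-move) equivalence of polygonal knots. The crossing number $c(K)$ of a knot $K$ is the smallest number of crossings in a diagram (regular projection with finitely many multiple points, all of them transversal double points) of a knot equivalent to $K$. An $n$-mosaic is an $n\times n$ matrix whose entries are among the eleven mosaic tiles: the blank tile; the four tiles with one arc joining the midpoints of two adjacent sides; the two tiles with one straight strand joining the midpoints of opposite sides; the two tiles with two disjoint arcs, each joining the midpoints of two adjacent sides; and the two crossing tiles, in which the horizontal and the vertical strand cross, one over the other. The endpoints of the strands of a tile are its connection points. A mosaic is suitably connected if every connection point of every tile touches a connection point of a contiguous tile; it is then a diagram of a link. The mosaic number of a knot $K$ is the smallest $n$ for which there is a suitably connected $n$-mosaic that depicts a knot (a link with exactly one component) equivalent to $K$. **Corollary.** Let $K$ be a knot with mosaic number $n$, where $n$ is even and $n>3$. Then its crossing number satisfies $$c(K)\le (n-2)^2-1 .$$ -/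

import Mathlib

namespace MosaicKnot

/-- Three-dimensional space, with coordinates `(x, y, z)`. -/
abbrev Space : Type := ℝ × ℝ × ℝ

/-! ### Polygonal (tame) knots and their equivalence -/

/-- `K` is a simple closed polygon: there are `m + 3` cyclically ordered vertices `v i` such that
`K` is the union of the edges `[v i, v (i + 1)]`, and the parametrization of the polygon by
half-open edges is injective, so that two edges meet only in a common endpoint of consecutive
ones. (Addition in `Fin (m + 3)` is cyclic.) -/
def IsSimpleClosedPolygon (K : Set Space) : Prop :=
  ∃ (m : ℕ) (v : Fin (m + 3) → Space),
    Set.InjOn (fun q : Fin (m + 3) × ℝ => (1 - q.2) • v q.1 + q.2 • v (q.1 + 1))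
      {q | 0 ≤ q.2 ∧ q.2 < 1} ∧
    K = ⋃ i, segment ℝ (v i) (v (i + 1))

/-- A polygonal knot. -/
structure Knot where
  /-- The points of the knot. -/
  carrier : Set Space
  isPolygon : IsSimpleClosedPolygon carrier

/-- An elementary (triangle) move: for a nondegenerate triangle `abc` that meets the knot exactly
in its side `[a, b]`, this side is replaced by the other two sides. -/
def Knot.TriangleMove (K K' : Knot) : Prop :=
  ∃ a b c : Space, AffineIndependent ℝ ![a, b, c] ∧
    convexHull ℝ {a, b, c} ∩ K.carrier = segment ℝ a b ∧
    K'.carrier = (K.carrier \ segment ℝ a b) ∪ (segment ℝ a c ∪ segment ℝ c b)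

/-- Two polygonal knots are equivalent (have the same knot type) if they are related by a finite
sequence of triangle moves and inverses of triangle moves. -/
def Knot.Equivalent : Knot → Knot → Prop := Relation.EqvGen Knot.TriangleMove

/-! ### Diagrams and the crossing number -/

/-- The orthogonal projection to the plane of the diagram. -/
def proj (p : Space) : ℝ × ℝ := (p.1, p.2.1)

/-- The points of the plane over which the knot has at least two points. -/
def Knot.crossings (K : Knot) : Set (ℝ × ℝ) :=
  {q | ∃ x ∈ K.carrier, ∃ y ∈ K.carrier, x ≠ y ∧ proj x = q ∧ proj y = q}

/-- The projection of `K` is a knot diagram (a regular projection): it has finitely many multiple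
points, all of them are double points, and at each of them two straight pieces of the knot cross
transversally. -/
def Knot.IsDiagram (K : Knot) : Prop :=
  K.crossings.Finite ∧
  (∀ x ∈ K.carrier, ∀ y ∈ K.carrier, ∀ z ∈ K.carrier,
    proj x = proj y → proj y = proj z → x = y ∨ y = z ∨ x = z) ∧
  (∀ x ∈ K.carrier, ∀ y ∈ K.carrier, x ≠ y → proj x = proj y →
    ∃ u v : Space, segment ℝ (x - u) (x + u) ⊆ K.carrier ∧ segment ℝ (y - v) (y + v) ⊆ K.carrier ∧
      LinearIndependent ℝ ![proj u, proj v])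

/-- The crossing number of (the knot type of) `K`: the least number of crossings of a diagram of a
knot equivalent to `K`. -/
noncomputable def Knot.crossingNumber (K : Knot) : ℕ∞ :=
  ⨅ D ∈ {D : Knot | K.Equivalent D ∧ D.IsDiagram}, D.crossings.encard

/-! ### Mosaics -/

/-- The four sides of a tile. -/
inductive Side
  | north | east | south | west
  deriving DecidableEq

/-- The eleven mosaic tiles. -/
inductive Tile
  | blank
  | arcWS | arcSE | arcEN | arcNW
  | horizontal | vertical
  | arcsWSEN | arcsNWSE
  | crossingHorizontalOver | crossingVerticalOver
  deriving DecidableEq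

/-- The strands of a tile; each of them joins the midpoints of two sides. -/
def Tile.strands : Tile → List (Side × Side)
  | .blank => []
  | .arcWS => [(.west, .south)]
  | .arcSE => [(.south, .east)]
  | .arcEN => [(.east, .north)]
  | .arcNW => [(.north, .west)]
  | .horizontal => [(.west, .east)]
  | .vertical => [(.north, .south)]
  | .arcsWSEN => [(.west, .south), (.east, .north)]
  | .arcsNWSE => [(.north, .west), (.south, .east)]
  | .crossingHorizontalOver => [(.west, .east), (.north, .south)]
  | .crossingVerticalOver => [(.west, .east), (.north, .south)]

/-- The tile `t` has a connection point on the side `s`. -/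
def Tile.HasPoint (t : Tile) (s : Side) : Prop :=
  ∃ p ∈ t.strands, p.1 = s ∨ p.2 = s

/-- An `n`-mosaic: an `n × n` matrix of tiles, the row index growing from north to south and the
column index from west to east. -/
abbrev Mosaic (n : ℕ) : Type := Matrix (Fin n) (Fin n) Tile

/-- Every connection point of every tile touches a connection point of a contiguous tile. (So no
tile has a connection point on the boundary of the mosaic.) -/
def Mosaic.SuitablyConnected {n : ℕ} (M : Mosaic n) : Prop :=
  ∀ i j : Fin n,
    ((M i j).HasPoint .north → ∃ k : Fin n, (k : ℕ) + 1 = i ∧ (M k j).HasPoint .south) ∧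
    ((M i j).HasPoint .south → ∃ k : Fin n, (k : ℕ) = i + 1 ∧ (M k j).HasPoint .north) ∧
    ((M i j).HasPoint .west → ∃ k : Fin n, (k : ℕ) + 1 = j ∧ (M i k).HasPoint .east) ∧
    ((M i j).HasPoint .east → ∃ k : Fin n, (k : ℕ) = j + 1 ∧ (M i k).HasPoint .west)

/-- The midpoints of the sides of the tile `[-2, 2] × [-2, 2]`, at height zero. -/
def Side.midpoint : Side → Space
  | .north => (0, 2, 0)
  | .east => (2, 0, 0)
  | .south => (0, -2, 0)
  | .west => (-2, 0, 0)

/-- The line segments in space that realize a tile over `[-2, 2] × [-2, 2]`: every strand is the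
straight segment between its two connection points at height zero, except that the upper strand
of a crossing is lifted to height one around the centre of the tile. -/
def Tile.segments : Tile → List (Space × Space)
  | .crossingHorizontalOver =>
      [(Side.west.midpoint, (-1, 0, 1)), ((-1, 0, 1), (1, 0, 1)), ((1, 0, 1), Side.east.midpoint),
        (Side.north.midpoint, Side.south.midpoint)]
  | .crossingVerticalOver =>
      [(Side.north.midpoint, (0, 1, 1)), ((0, 1, 1), (0, -1, 1)), ((0, -1, 1), Side.south.midpoint),
        (Side.west.midpoint, Side.east.midpoint)]
  | t => t.strands.map fun p => (p.1.midpoint, p.2.midpoint)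

/-- The centre of the tile in row `i` and column `j`. -/
def tileCenter (i j : ℕ) : Space := (4 * (j : ℝ), -4 * (i : ℝ), 0)

/-- The points in space of the link that is drawn by the mosaic. -/
def Mosaic.link {n : ℕ} (M : Mosaic n) : Set Space :=
  ⋃ (i : Fin n) (j : Fin n), ⋃ p ∈ (M i j).segments,
    segment ℝ (tileCenter i j + p.1) (tileCenter i j + p.2)

/-- `M` is a mosaic of the knot type of `K`: it is suitably connected, and the link that it draws
is a knot (has exactly one component) equivalent to `K`. -/
def Mosaic.Represents {n : ℕ} (M : Mosaic n) (K : Knot) : Prop :=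
  M.SuitablyConnected ∧ ∃ K' : Knot, K'.carrier = M.link ∧ K.Equivalent K'

/-- The mosaic number of (the knot type of) `K`: the least `n` for which there is an `n`-mosaic
of it. -/
noncomputable def Knot.mosaicNumber (K : Knot) : ℕ∞ :=
  ⨅ n ∈ {n : ℕ | ∃ M : Mosaic n, M.Represents K}, (n : ℕ∞)

end MosaicKnot

namespace MosaicKnot

open Set

/-! A crossing tile has connection points on all four sides, so it cannot lie on the border. A
mosaic therefore has at most `(n - 2) ^ 2` crossings, and only one has to be saved. If some interior
tile is not a crossing, the link drawn by the mosaic is already a good enough diagram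
(`diagram_of_pieces`).

Otherwise the interior consists of crossings, and the border is almost forced: every top tile off
the corners is `arcWS` or `arcSE`, and the two alternate. If tile `(0, 1)` is `arcWS`, the
north-west corner closes a loop at the crossing in tile `(1, 1)`. This kink is undone by a
Reidemeister I move, realized as three inverse triangle moves (`exists_shortcut`,
`exists_diagram_of_kink`), and its crossing disappears. If tile `(0, 1)` is `arcSE`, evenness of `n`
makes the north-east corner unused too. Strands run straight through crossings, so the strand along
row 1 turns into row 2 at both ends and closes up there, separate from the rest: the link is not a
knot (`IsMosaicGrid.not_isPolygon`).

For the geometry, a knot is treated as a 2-regular connected graph of straight segments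
(`IsPolygon`); removing a vertex across an empty triangle is an inverse triangle move
(`bypass_triangleMove`). Each tile lies in an octahedron, and octahedra of different tiles meet at
most in the midpoint of a common side (`eq_midpoint_of_inBall`), so intersections and crossings can
be checked tile by tile. -/

/-! ### Polygons as 2-regular graphs in space -/

/-- The union of the segments spanned by the edges of a graph in space. -/
def carrier (G : SimpleGraph Space) : Set Space :=
  {x | ∃ a b, G.Adj a b ∧ x ∈ segment ℝ a b}

/-- Edges of `G` meet only in common endpoints. -/
def EdgesDisjoint (G : SimpleGraph Space) : Prop :=
  ∀ a b c d, G.Adj a b → G.Adj c d → s(a, b) ≠ s(c, d) →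
    ∀ x ∈ segment ℝ a b, x ∈ segment ℝ c d → (x = a ∨ x = b) ∧ (x = c ∨ x = d)

/-- A finite connected graph in space all of whose vertices have degree two and whose edges, drawn
as segments, meet only in common endpoints. -/
structure IsPolygon (G : SimpleGraph Space) : Prop where
  finite : {a | ∃ b, G.Adj a b}.Finite
  degree : ∀ a b, G.Adj a b → ∃ c d, c ≠ d ∧ ∀ x, G.Adj a x ↔ x = c ∨ x = d
  disjoint : EdgesDisjoint G
  connected : ∀ S : Set Space, (∀ a b, G.Adj a b → a ∈ S → b ∈ S) →
    ∀ a b a' b', G.Adj a b → G.Adj a' b' → a ∈ S → a' ∈ S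
  nonempty : ∃ a b, G.Adj a b

lemma lineMap_left_injective {a b : Space} (hab : a ≠ b) {s t : ℝ}
    (h : (1 - s) • a + s • b = (1 - t) • a + t • b) : s = t := by
  have h1 : (s - t) • (b - a) = 0 := by
    have : (s - t) • (b - a) = ((1 - s) • a + s • b) - ((1 - t) • a + t • b) := by module
    rw [this, h, sub_self]
  rcases smul_eq_zero.1 h1 with h2 | h2
  · linarith
  · exact absurd (sub_eq_zero.1 h2).symm hab

lemma mem_segment_of_combo {a b : Space} {t : ℝ} (h0 : 0 ≤ t) (h1 : t < 1) :
    (1 - t) • a + t • b ∈ segment ℝ a b :=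
  ⟨1 - t, t, by linarith, h0, by ring, rfl⟩

/-- A cyclic sequence of distinct vertices that runs through the edges of `G`. -/
lemma IsPolygon.exists_cycle {G : SimpleGraph Space} (h : IsPolygon G) :
    ∃ (m : ℕ) (v : Fin (m + 3) → Space), Function.Injective v ∧
      ∀ a b, G.Adj a b ↔ ∃ i, s(v i, v (i + 1)) = s(a, b) := by
  classical
  let V := {a | ∃ b, G.Adj a b}
  have : Finite V := h.finite.to_subtype
  let H : SimpleGraph V := G.comap Subtype.val
  have hcyc : H.IsCycles := by
    rintro ⟨a, ha⟩ -
    obtain ⟨b, hb⟩ := ha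
    obtain ⟨c, d, hcd, hx⟩ := h.degree a b hb
    have hc : G.Adj a c := (hx c).2 (Or.inl rfl)
    have hd : G.Adj a d := (hx d).2 (Or.inr rfl)
    rw [Set.ncard_eq_two]
    refine ⟨⟨c, a, hc.symm⟩, ⟨d, a, hd.symm⟩, by simpa using hcd, ?_⟩
    ext ⟨x, hxV⟩
    simp only [SimpleGraph.mem_neighborSet, H, SimpleGraph.comap_adj, hx, Set.mem_insert_iff,
      Set.mem_singleton_iff, Subtype.mk.injEq]
  obtain ⟨a0, b0, h0⟩ := h.nonempty
  let v0 : V := ⟨a0, b0, h0⟩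
  have hreach : ∀ x : V, H.Reachable v0 x := by
    intro x
    obtain ⟨a, b, hab⟩ := x
    have := h.connected {y | ∃ hy : y ∈ V, H.Reachable v0 ⟨y, hy⟩} (by
      rintro y z hyz ⟨hy, hr⟩
      refine ⟨⟨y, hyz.symm⟩, hr.trans (SimpleGraph.Adj.reachable ?_)⟩
      exact hyz) a0 b0 a b h0 hab ⟨⟨b0, h0⟩, SimpleGraph.Reachable.refl _⟩
    exact this.2
  -- In a 2-regular finite graph the component of `v0` is traced by a cycle; by `hreach` that
  -- component is everything.
  obtain ⟨p, hp, hverts⟩ := hcyc.exists_cycle_toSubgraph_verts_eq_connectedComponentSupp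
    (v := v0) (c := H.connectedComponentMk v0) rfl ⟨⟨b0, a0, h0.symm⟩, h0⟩
  have hall : ∀ x : V, x ∈ p.toSubgraph.verts := by
    intro x
    rw [hverts]
    exact SimpleGraph.ConnectedComponent.sound (hreach x).symm
  have : H.LocallyFinite := fun x => Fintype.ofFinite _
  have hlen := hp.three_le_length
  obtain ⟨m, hm⟩ := Nat.exists_eq_add_of_le' hlen
  have hinj : ∀ i j : ℕ, i < m + 3 → j < m + 3 → p.getVert i = p.getVert j → i = j := by
    intro i j hi hj hij
    refine hp.getVert_injOn' ?_ ?_ hij <;> simp only [Set.mem_ofPred_eq] <;> omega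
  have hsucc : ∀ i : Fin (m + 3), p.getVert ((i + 1 : Fin (m + 3)) : ℕ) = p.getVert (i + 1) := by
    intro i
    by_cases hi : (i : ℕ) + 1 < m + 3
    · congr 1
      rw [Fin.val_add, Fin.val_one, Nat.mod_eq_of_lt hi]
    -- Wrap-around: the successor of the last index is `0` in `Fin (m + 3)`, and the closed walk is
    -- back at its start.
    · have h1 : (i : ℕ) + 1 = m + 3 := by have := i.2; omega
      rw [h1, Fin.val_add, Fin.val_one, h1, Nat.mod_self, ← hm]
      simp
  refine ⟨m, fun i => (p.getVert i : Space), ?_, ?_⟩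
  · intro i j hij
    exact Fin.ext (hinj i j i.2 j.2 (Subtype.ext hij))
  · intro a b
    simp only [hsucc]
    constructor
    · intro hab
      have hadj : p.toSubgraph.Adj ⟨a, b, hab⟩ ⟨b, a, hab.symm⟩ :=
        (hp.adj_toSubgraph_iff_of_isCycles hcyc (hall _) _).2 hab
      obtain ⟨i, hi, hil⟩ := p.toSubgraph_adj_iff.1 hadj
      refine ⟨⟨i, by omega⟩, ?_⟩
      have := congrArg (Sym2.map (Subtype.val : V → Space)) hi
      simpa using this
    · rintro ⟨i, hi⟩
      have hadj := p.adj_getVert_succ (i := i) (by have := i.2; omega)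
      have hG : G.Adj (p.getVert i : Space) (p.getVert (i + 1) : Space) := hadj
      rcases Sym2.eq_iff.1 hi with ⟨rfl, rfl⟩ | ⟨rfl, rfl⟩
      · exact hG
      · exact hG.symm

lemma IsPolygon.isSimpleClosedPolygon {G : SimpleGraph Space} (h : IsPolygon G) :
    IsSimpleClosedPolygon (carrier G) := by
  obtain ⟨m, v, hv, hadj⟩ := h.exists_cycle
  have hA : ∀ i, G.Adj (v i) (v (i + 1)) := fun i => (hadj _ _).2 ⟨i, rfl⟩
  refine ⟨m, v, ?_, ?_⟩
  · rintro ⟨i, s⟩ ⟨hs0, hs1⟩ ⟨j, t⟩ ⟨ht0, ht1⟩ hst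
    simp only at hs0 hs1 ht0 ht1 hst
    by_cases hij : i = j
    · subst hij
      rw [lineMap_left_injective (hA i).ne hst]
    · exfalso
      have hne : s(v i, v (i + 1)) ≠ s(v j, v (j + 1)) := by
        intro he
        rcases Sym2.eq_iff.1 he with ⟨h1, -⟩ | ⟨h1, h2⟩
        · exact hij (hv h1)
        · have h1 := hv h1
          have h2 := hv h2
          rw [h1, add_assoc] at h2
          -- The same edge run through in opposite directions would need a cycle of length two.
          have h3 : (1 + 1 : Fin (m + 3)) = 0 := by simpa using h2
          have := congrArg Fin.val h3
          rw [Fin.val_add, Fin.val_one, Fin.val_zero, Nat.mod_eq_of_lt (by omega)] at this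
          omega
      -- A half-open edge contains only its left end, so a common point would be the left end of
      -- both edges, against injectivity of `v`.
      have hleft : ∀ k : Fin (m + 3), ∀ r : ℝ, 0 ≤ r → r < 1 →
          ((1 - r) • v k + r • v (k + 1) = v k ∨ (1 - r) • v k + r • v (k + 1) = v (k + 1)) →
          (1 - r) • v k + r • v (k + 1) = v k := by
        rintro k r - h1 (h2 | h2)
        · exact h2
        · have : r = 1 := lineMap_left_injective (hA k).ne (by rw [h2]; simp)
          linarith
      obtain ⟨h1, h2⟩ := h.disjoint _ _ _ _ (hA i) (hA j) hne _ (mem_segment_of_combo hs0 hs1)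
        (by rw [hst]; exact mem_segment_of_combo ht0 ht1)
      have h1 := hleft i s hs0 hs1 h1
      rw [hst] at h2
      have h2 := hleft j t ht0 ht1 h2
      exact hij (hv (by rw [← h1, ← h2, hst]))
  · ext x
    simp only [carrier, Set.mem_iUnion, Set.mem_ofPred_eq]
    constructor
    · rintro ⟨a, b, hab, hx⟩
      obtain ⟨i, hi⟩ := (hadj a b).1 hab
      refine ⟨i, ?_⟩
      rcases Sym2.eq_iff.1 hi with ⟨h1, h2⟩ | ⟨h1, h2⟩
      · rwa [h1, h2]
      · rwa [h1, h2, segment_symm]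
    · rintro ⟨i, hx⟩
      exact ⟨_, _, hA i, hx⟩

/-- Topological connectedness is how the one-component hypothesis on a mosaic is passed on to its
graph, whose edges need not be those of the given polygon. -/
lemma IsSimpleClosedPolygon.isPreconnected {K : Set Space} (h : IsSimpleClosedPolygon K) :
    IsPreconnected K := by
  obtain ⟨m, v, -, rfl⟩ := h
  have : (⋃ i, segment ℝ (v i) (v (i + 1))) =
      ⋃ k : ℕ, segment ℝ (v (Fin.ofNat (m + 3) k)) (v (Fin.ofNat (m + 3) k + 1)) := by
    ext x
    simp only [Set.mem_iUnion]
    constructor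
    · rintro ⟨i, hi⟩
      refine ⟨i, ?_⟩
      rwa [show Fin.ofNat (m + 3) (i : ℕ) = i from Fin.ext (by simp)]
    · rintro ⟨k, hk⟩
      exact ⟨_, hk⟩
  rw [this]
  refine IsPreconnected.iUnion_of_chain (fun k => (convex_segment _ _).isPreconnected) fun k => ?_
  refine ⟨v (Fin.ofNat (m + 3) k + 1), right_mem_segment _ _ _, ?_⟩
  have : Fin.ofNat (m + 3) (Order.succ k) = Fin.ofNat (m + 3) k + 1 := by
    apply Fin.ext
    simp [Fin.val_add]
  rw [this]
  exact left_mem_segment _ _ _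

/-- A graph with disjoint edges and preconnected carrier is connected. -/
lemma connected_of_isPreconnected {G : SimpleGraph Space} (hfin : {a | ∃ b, G.Adj a b}.Finite)
    (hd : EdgesDisjoint G) (hK : IsPreconnected (carrier G)) (S : Set Space)
    (hS : ∀ a b, G.Adj a b → a ∈ S → b ∈ S) (a b a' b' : Space) (hab : G.Adj a b)
    (hab' : G.Adj a' b') (ha : a ∈ S) : a' ∈ S := by
  by_contra ha'
  have hclosed : ∀ T : Set Space, IsClosed {x | ∃ a b, G.Adj a b ∧ a ∈ T ∧ x ∈ segment ℝ a b} := by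
    intro T
    have hE : {q : Space × Space | G.Adj q.1 q.2 ∧ q.1 ∈ T}.Finite := by
      refine (hfin.prod hfin).subset ?_
      rintro ⟨x, y⟩ ⟨hxy, -⟩
      exact ⟨⟨y, hxy⟩, ⟨x, hxy.symm⟩⟩
    have : {x | ∃ a b, G.Adj a b ∧ a ∈ T ∧ x ∈ segment ℝ a b} =
        ⋃ q ∈ {q : Space × Space | G.Adj q.1 q.2 ∧ q.1 ∈ T}, segment ℝ q.1 q.2 := by
      ext x
      simp only [Set.mem_ofPred_eq, Set.mem_iUnion, Prod.exists, exists_prop, and_assoc]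
    rw [this]
    refine hE.isClosed_biUnion fun q _ => ?_
    rw [segment_eq_image]
    exact (isCompact_Icc.image (by fun_prop)).isClosed
  -- Connectedness yields a point common to an edge with ends in `S` and an edge with ends outside
  -- `S`. By disjointness it would be a vertex of both.
  obtain ⟨x, -, ⟨c, d, hcd, hc, hx⟩, ⟨c', d', hcd', hc', hx'⟩⟩ :=
    (isPreconnected_closed_iff.1 hK) _ _ (hclosed S) (hclosed Sᶜ)
      (by
        rintro x ⟨c, d, hcd, hx⟩
        by_cases hc : c ∈ S
        · exact Or.inl ⟨c, d, hcd, hc, hx⟩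
        · exact Or.inr ⟨c, d, hcd, hc, hx⟩)
      ⟨a, ⟨a, b, hab, left_mem_segment _ _ _⟩, a, b, hab, ha, left_mem_segment _ _ _⟩
      ⟨a', ⟨a', b', hab', left_mem_segment _ _ _⟩, a', b', hab', ha', left_mem_segment _ _ _⟩
  have hd1 : d ∈ S := hS _ _ hcd hc
  have hd2 : d' ∉ S := fun h => hc' (hS _ _ hcd'.symm h)
  have hne : s(c, d) ≠ s(c', d') := by
    intro he
    rcases Sym2.eq_iff.1 he with ⟨rfl, -⟩ | ⟨rfl, rfl⟩
    · exact hc' hc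
    · exact hd2 hc
  obtain ⟨h1, h2⟩ := hd _ _ _ _ hcd hcd' hne x hx hx'
  rcases h1 with rfl | rfl <;> rcases h2 with rfl | rfl <;> contradiction

/-! ### Triangle moves as removal of a vertex -/

/-- The graph obtained from `G` by removing the vertex `c` and joining `a` to `b`. -/
def bypass (G : SimpleGraph Space) (a b c : Space) : SimpleGraph Space :=
  SimpleGraph.fromRel fun x y => (G.Adj x y ∧ x ≠ c ∧ y ≠ c) ∨ (x = a ∧ y = b)

lemma bypass_adj {G : SimpleGraph Space} {a b c : Space} (hab : a ≠ b) (x y : Space) :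
    (bypass G a b c).Adj x y ↔
      (G.Adj x y ∧ x ≠ c ∧ y ≠ c) ∨ (x = a ∧ y = b) ∨ (x = b ∧ y = a) := by
  simp only [bypass, SimpleGraph.fromRel_adj]
  constructor
  · rintro ⟨-, (h | h) | (h | h)⟩
    · exact Or.inl h
    · exact Or.inr (Or.inl h)
    · exact Or.inl ⟨h.1.symm, h.2.2, h.2.1⟩
    · exact Or.inr (Or.inr h.symm)
  · rintro (h | ⟨rfl, rfl⟩ | ⟨rfl, rfl⟩)
    · exact ⟨h.1.ne, Or.inl (Or.inl h)⟩
    · exact ⟨hab, Or.inl (Or.inr ⟨rfl, rfl⟩)⟩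
    · exact ⟨hab.symm, Or.inr (Or.inr ⟨rfl, rfl⟩)⟩

lemma affineIndependent_triple {a b c : Space}
    (h : ∀ s t : ℝ, s • (b - a) + t • (c - a) = 0 → s = 0 ∧ t = 0) :
    AffineIndependent ℝ ![a, b, c] := by
  rw [affineIndependent_iff_of_fintype]
  intro w hw h0
  rw [Finset.univ.weightedVSub_eq_linear_combination hw] at h0
  simp only [Fin.sum_univ_three, Matrix.cons_val_zero, Matrix.cons_val_one, Matrix.cons_val] at hw h0
  have h1 : w 0 = -w 1 - w 2 := by linarith
  obtain ⟨h2, h3⟩ := h (w 1) (w 2) (by rw [← h0, h1]; module)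
  intro i
  fin_cases i
  · simp [h1, h2, h3]
  · exact h2
  · exact h3

/-- The triangle `abc` meets the edges of `G` that avoid `c` at most in `a` and `b`. -/
def TriangleFree (G : SimpleGraph Space) (a b c : Space) : Prop :=
  ∀ x y, G.Adj x y → x ≠ c → y ≠ c → ∀ z ∈ convexHull ℝ {a, b, c}, z ∈ segment ℝ x y →
    z = a ∨ z = b

lemma segment_subset_triangle (a b c : Space) : segment ℝ a b ⊆ convexHull ℝ {a, b, c} :=
  segment_subset_convexHull (by simp) (by simp)

lemma IsPolygon.degree_two {G : SimpleGraph Space} (h : IsPolygon G) {a b c : Space}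
    (hac : G.Adj a c) (hcb : G.Adj c b) (hab : a ≠ b) (x : Space) :
    G.Adj c x ↔ x = a ∨ x = b := by
  obtain ⟨d, e, -, hx⟩ := h.degree c a hac.symm
  have h1 := (hx a).1 hac.symm
  have h2 := (hx b).1 hcb
  rw [hx]
  grind

/-- An edge `ab` would meet the triangle in its midpoint, which is neither `a` nor `b`. -/
lemma IsPolygon.not_adj {G : SimpleGraph Space} {a b c : Space}
    (hac : G.Adj a c) (hcb : G.Adj c b) (hab : a ≠ b) (ht : TriangleFree G a b c) :
    ¬ G.Adj a b := by
  intro h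
  have hm : midpoint ℝ a b ∈ segment ℝ a b := midpoint_mem_segment a b
  rcases ht a b h hac.ne hcb.symm.ne _ (segment_subset_triangle _ _ _ hm) hm with h1 | h1
  · rw [midpoint_eq_left_iff] at h1
    exact hab h1
  · rw [midpoint_eq_right_iff] at h1
    exact hab h1

/-- The new edge is a side of the triangle, so an old edge can meet it only in `a` or `b`. There the
old edge also meets `ac` or `cb`, and disjointness in `G` makes the point a vertex of the old edge.
-/
lemma bypass_disjoint_aux {G : SimpleGraph Space} (h : IsPolygon G) {a b c : Space}
    (hac : G.Adj a c) (hcb : G.Adj c b) (ht : TriangleFree G a b c)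
    {x y z : Space} (hxy : G.Adj x y) (hx : x ≠ c) (hy : y ≠ c) (hz : z ∈ segment ℝ x y)
    (hz' : z ∈ segment ℝ a b) : (z = x ∨ z = y) ∧ (z = a ∨ z = b) := by
  have hzab := ht x y hxy hx hy z (segment_subset_triangle _ _ _ hz') hz
  refine ⟨?_, hzab⟩
  rcases hzab with rfl | rfl
  · refine (h.disjoint x y z c hxy hac ?_ z hz (left_mem_segment _ _ _)).1
    intro he
    rcases Sym2.eq_iff.1 he with ⟨-, h2⟩ | ⟨h2, -⟩ <;> contradiction
  · refine (h.disjoint x y c z hxy hcb ?_ z hz (right_mem_segment _ _ _)).1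
    intro he
    rcases Sym2.eq_iff.1 he with ⟨h2, -⟩ | ⟨-, h2⟩ <;> contradiction

/-- The degrees of `a` and `b` stay two because each exchanges the neighbour `c` for the other one,
which is new to it by `IsPolygon.not_adj`. -/
lemma IsPolygon.isPolygon_bypass {G : SimpleGraph Space} (h : IsPolygon G) {a b c : Space}
    (hac : G.Adj a c) (hcb : G.Adj c b) (hab : a ≠ b) (ht : TriangleFree G a b c) :
    IsPolygon (bypass G a b c) := by
  have hca := hac.ne
  have hcb' := hcb.ne
  have hc := h.degree_two hac hcb hab
  have hnab := IsPolygon.not_adj hac hcb hab ht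
  refine ⟨?_, ?_, ?_, ?_, ?_⟩
  · refine h.finite.subset ?_
    rintro x ⟨y, hxy⟩
    rcases (bypass_adj hab x y).1 hxy with h1 | ⟨rfl, -⟩ | ⟨rfl, -⟩
    · exact ⟨y, h1.1⟩
    · exact ⟨c, hac⟩
    · exact ⟨c, hcb.symm⟩
  · have hother : ∀ a b, a ≠ b → G.Adj a c → ¬ G.Adj a b → b ≠ c →
        ∃ d e, d ≠ e ∧ ∀ x, ((G.Adj a x ∧ a ≠ c ∧ x ≠ c) ∨ x = b) ↔ x = d ∨ x = e := by
      intro a b hab hac hnab hbc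
      obtain ⟨d, e, hde, hx⟩ := h.degree a c hac
      have h1 := (hx c).1 hac
      have h2 : ¬ (b = d ∨ b = e) := fun h => hnab ((hx b).2 h)
      have h3 := hac.ne
      rcases h1 with rfl | rfl
      · refine ⟨b, e, fun h => h2 (Or.inr h), fun x => ?_⟩
        rw [hx]
        grind
      · refine ⟨b, d, fun h => h2 (Or.inl h), fun x => ?_⟩
        rw [hx]
        grind
    intro x y hxy
    by_cases hxa : x = a
    · subst hxa
      obtain ⟨d, e, hde, hx⟩ := hother x b hab hac hnab hcb'.symm
      refine ⟨d, e, hde, fun y => ?_⟩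
      rw [← hx, bypass_adj hab]
      grind
    by_cases hxb : x = b
    · subst hxb
      obtain ⟨d, e, hde, hx⟩ := hother x a hab.symm hcb.symm (fun h => hnab h.symm) hca
      refine ⟨d, e, hde, fun y => ?_⟩
      rw [← hx, bypass_adj hab]
      grind
    have hxy' := (bypass_adj hab x y).1 hxy
    obtain ⟨d, e, hde, hx⟩ := h.degree x y (by tauto)
    refine ⟨d, e, hde, fun z => ?_⟩
    rw [← hx, bypass_adj hab]
    constructor
    · tauto
    · intro hz
      refine Or.inl ⟨hz, by tauto, ?_⟩
      rintro rfl
      exact ((hc x).1 hz.symm).elim hxa hxb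
  · intro x y x' y' hxy hxy' hne z hz hz'
    rcases (bypass_adj hab x y).1 hxy with h1 | ⟨rfl, rfl⟩ | ⟨rfl, rfl⟩ <;>
    rcases (bypass_adj hab x' y').1 hxy' with h2 | ⟨rfl, rfl⟩ | ⟨rfl, rfl⟩
    · exact h.disjoint _ _ _ _ h1.1 h2.1 hne z hz hz'
    · exact bypass_disjoint_aux h hac hcb ht h1.1 h1.2.1 h1.2.2 hz hz'
    · rw [segment_symm] at hz'
      exact (bypass_disjoint_aux h hac hcb ht h1.1 h1.2.1 h1.2.2 hz hz').imp_right Or.symm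
    · exact (bypass_disjoint_aux h hac hcb ht h2.1 h2.2.1 h2.2.2 hz' hz).symm
    · exact absurd rfl hne
    · exact absurd Sym2.eq_swap hne
    · rw [segment_symm] at hz
      exact ((bypass_disjoint_aux h hac hcb ht h2.1 h2.2.1 h2.2.2 hz' hz).imp_right Or.symm).symm
    · exact absurd Sym2.eq_swap hne
    · exact absurd rfl hne
  · intro S hS
    have hSab : a ∈ S ↔ b ∈ S :=
      ⟨hS a b ((bypass_adj hab a b).2 (by simp)), hS b a ((bypass_adj hab b a).2 (by simp))⟩
    -- An adjacency-closed set of the new graph becomes one of `G` when `c` is put on the side of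
    -- `a` and `b`.
    have key := h.connected {x | (x ≠ c ∧ x ∈ S) ∨ (x = c ∧ a ∈ S)} (by
      rintro x y hxy (⟨hx, hxS⟩ | ⟨rfl, haS⟩)
      · by_cases hy : y = c
        · subst hy
          refine Or.inr ⟨rfl, ?_⟩
          rcases (hc x).1 hxy.symm with rfl | rfl
          · exact hxS
          · exact hSab.2 hxS
        · exact Or.inl ⟨hy, hS x y ((bypass_adj hab x y).2 (Or.inl ⟨hxy, hx, hy⟩)) hxS⟩
      · refine Or.inl ⟨hxy.ne', ?_⟩
        rcases (hc y).1 hxy with rfl | rfl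
        · exact haS
        · exact hSab.1 haS)
    have hv : ∀ x y, (bypass G a b c).Adj x y → x ≠ c ∧ ∃ z, G.Adj x z := by
      intro x y hxy
      rcases (bypass_adj hab x y).1 hxy with h1 | ⟨rfl, -⟩ | ⟨rfl, -⟩
      · exact ⟨h1.2.1, y, h1.1⟩
      · exact ⟨hca, c, hac⟩
      · exact ⟨hcb'.symm, c, hcb.symm⟩
    intro x y x' y' hxy hxy' hx
    obtain ⟨h1, z, hz⟩ := hv x y hxy
    obtain ⟨h2, z', hz'⟩ := hv x' y' hxy'
    rcases key x z x' z' hz hz' (Or.inl ⟨h1, hx⟩) with h3 | h3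
    · exact h3.2
    · exact absurd h3.1 h2
  · exact ⟨a, b, (bypass_adj hab a b).2 (by simp)⟩

/-- A triangle move replaces one side by two, so the move leads from the shortened knot `K'` back to
`K`. -/
lemma bypass_triangleMove {G : SimpleGraph Space} (h : IsPolygon G) {a b c : Space}
    (hac : G.Adj a c) (hcb : G.Adj c b) (hind : AffineIndependent ℝ ![a, b, c])
    (ht : TriangleFree G a b c) {K K' : Knot} (hK : K.carrier = carrier G)
    (hK' : K'.carrier = carrier (bypass G a b c)) : K'.TriangleMove K := by
  have hab : a ≠ b := fun h => by
    have := hind.injective (a₁ := 0) (a₂ := 1) (by simpa using h)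
    simp at this
  have hc := h.degree_two hac hcb hab
  refine ⟨a, b, c, hind, ?_, ?_⟩
  · rw [hK']
    ext z
    constructor
    · rintro ⟨hz, x, y, hxy, hzs⟩
      rcases (bypass_adj hab x y).1 hxy with h1 | ⟨rfl, rfl⟩ | ⟨rfl, rfl⟩
      · rcases ht x y h1.1 h1.2.1 h1.2.2 z hz hzs with rfl | rfl
        · exact left_mem_segment _ _ _
        · exact right_mem_segment _ _ _
      · exact hzs
      · rwa [segment_symm]
    · intro hz
      exact ⟨segment_subset_triangle _ _ _ hz, a, b, (bypass_adj hab a b).2 (by simp), hz⟩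
  · rw [hK, hK']
    ext z
    constructor
    · rintro ⟨x, y, hxy, hz⟩
      by_cases hx : x = c
      · subst hx
        rcases (hc y).1 hxy with rfl | rfl
        · rw [segment_symm] at hz
          exact Or.inr (Or.inl hz)
        · exact Or.inr (Or.inr hz)
      by_cases hy : y = c
      · subst hy
        rcases (hc x).1 hxy.symm with rfl | rfl
        · exact Or.inr (Or.inl hz)
        · rw [segment_symm] at hz
          exact Or.inr (Or.inr hz)
      by_cases hzs : z ∈ segment ℝ a b
      · rcases ht x y hxy hx hy z (segment_subset_triangle _ _ _ hzs) hz with rfl | rfl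
        · exact Or.inr (Or.inl (left_mem_segment _ _ _))
        · exact Or.inr (Or.inr (right_mem_segment _ _ _))
      · exact Or.inl ⟨⟨x, y, (bypass_adj hab x y).2 (Or.inl ⟨hxy, hx, hy⟩), hz⟩, hzs⟩
    · rintro (⟨⟨x, y, hxy, hz⟩, hzs⟩ | hz | hz)
      · rcases (bypass_adj hab x y).1 hxy with h1 | ⟨rfl, rfl⟩ | ⟨rfl, rfl⟩
        · exact ⟨x, y, h1.1, hz⟩
        · exact absurd hz hzs
        · rw [segment_symm] at hz
          exact absurd hz hzs
      · exact ⟨a, c, hac, hz⟩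
      · exact ⟨c, b, hcb, hz⟩

/-! ### Geometry of a single tile -/

lemma exists_coord_of_mem_segment {a b x : Space} (h : x ∈ segment ℝ a b) :
    ∃ s : ℝ, 0 ≤ s ∧ s ≤ 1 ∧ x.1 = a.1 + s * (b.1 - a.1) ∧
      x.2.1 = a.2.1 + s * (b.2.1 - a.2.1) ∧ x.2.2 = a.2.2 + s * (b.2.2 - a.2.2) := by
  obtain ⟨r, s, hr, hs, hrs, rfl⟩ := h
  obtain rfl : r = 1 - s := by linarith
  refine ⟨s, hs, by linarith, ?_, ?_, ?_⟩ <;> simp <;> ring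

lemma sub_mem_segment {a b x c : Space} :
    x - c ∈ segment ℝ (a - c) (b - c) ↔ x ∈ segment ℝ a b := by
  simp [sub_eq_neg_add]

/-- The octahedron of radius two around the origin. -/
def InBall (x : Space) : Prop := |x.1| + |x.2.1| + |x.2.2| ≤ 2

lemma InBall.segment {a b x : Space} (ha : InBall a) (hb : InBall b) (hx : x ∈ segment ℝ a b) :
    InBall x := by
  obtain ⟨r, s, hr, hs, hrs, rfl⟩ := hx
  unfold InBall at *
  have key : ∀ p q : ℝ, |r * p + s * q| ≤ r * |p| + s * |q| := fun p q => by
    refine (abs_add_le _ _).trans ?_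
    rw [abs_mul, abs_mul, abs_of_nonneg hr, abs_of_nonneg hs]
  have h1 := key a.1 b.1
  have h2 := key a.2.1 b.2.1
  have h3 := key a.2.2 b.2.2
  simp only [Prod.fst_add, Prod.smul_fst, Prod.snd_add, Prod.smul_snd, smul_eq_mul]
  have h4 := mul_le_mul_of_nonneg_left ha hr
  have h5 := mul_le_mul_of_nonneg_left hb hs
  have h6 : r * 2 + s * 2 = 2 := by linarith
  nlinarith

/-- The segment `[a, b]` is one of the segments of the tile `t`. -/
def Tile.Edge (t : Tile) (a b : Space) : Prop := (a, b) ∈ t.segments ∨ (b, a) ∈ t.segments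

lemma Tile.Edge.symm {t : Tile} {a b : Space} (h : t.Edge a b) : t.Edge b a := Or.symm h

/-- The points of the tile `t`, drawn around the origin. -/
def Tile.points (t : Tile) : Set Space := {x | ∃ a b, t.Edge a b ∧ x ∈ segment ℝ a b}

lemma Tile.inBall_of_mem_segments {t : Tile} {p : Space × Space} (h : p ∈ t.segments) :
    InBall p.1 ∧ InBall p.2 := by
  cases t <;> simp only [Tile.segments, Tile.strands, Side.midpoint, List.map] at h <;>
  fin_cases h <;> norm_num [InBall]

lemma Tile.ne_of_mem_segments {t : Tile} {p : Space × Space} (h : p ∈ t.segments) :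
    p.1 ≠ p.2 := by
  cases t <;> simp only [Tile.segments, Tile.strands, Side.midpoint, List.map] at h <;>
  fin_cases h <;> norm_num

lemma Tile.Edge.inBall {t : Tile} {a b : Space} (h : t.Edge a b) : InBall a :=
  h.elim (fun h => (Tile.inBall_of_mem_segments h).1) fun h => (Tile.inBall_of_mem_segments h).2

lemma Tile.Edge.ne {t : Tile} {a b : Space} (h : t.Edge a b) : a ≠ b :=
  h.elim Tile.ne_of_mem_segments fun h => (Tile.ne_of_mem_segments h).symm

lemma Tile.Edge.inBall_of_mem {t : Tile} {a b x : Space} (h : t.Edge a b)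
    (hx : x ∈ segment ℝ a b) : InBall x := h.inBall.segment h.symm.inBall hx

/-- The other end of the segment of `t` that starts on the side `s`. -/
def Tile.arm : Tile → Side → Space
  | .crossingHorizontalOver, .west => (-1, 0, 1)
  | .crossingHorizontalOver, .east => (1, 0, 1)
  | .crossingVerticalOver, .north => (0, 1, 1)
  | .crossingVerticalOver, .south => (0, -1, 1)
  | .arcWS, .west | .vertical, .north | .arcsWSEN, .west | .crossingHorizontalOver, .north
  | .arcSE, .east | .arcsNWSE, .east => Side.south.midpoint
  | .arcWS, .south | .horizontal, .east | .arcsWSEN, .south | .crossingVerticalOver, .east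
  | .arcNW, .north | .arcsNWSE, .north => Side.west.midpoint
  | .arcSE, .south | .horizontal, .west | .arcsNWSE, .south | .crossingVerticalOver, .west
  | .arcEN, .north | .arcsWSEN, .north => Side.east.midpoint
  | _, _ => Side.north.midpoint

/-- Exactly one segment of the tile ends at each connection point; the two tiles sharing the point
together give it degree two. -/
lemma Tile.edge_midpoint_iff {t : Tile} {s : Side} (h : t.HasPoint s) (x : Space) :
    t.Edge s.midpoint x ↔ x = t.arm s := by
  revert h
  cases t <;> cases s <;>
  simp [Tile.HasPoint, Tile.Edge, Tile.segments, Tile.strands, Side.midpoint, Tile.arm] <;> norm_num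

/-- Every vertex of a tile is a connection point or lies inside the tile. -/
def Tile.VertexKind (t : Tile) (a : Space) : Prop :=
  (∃ s : Side, t.HasPoint s ∧ a = s.midpoint) ∨
    (|a.1| + |a.2.1| < 2 ∧ ∃ c d, c ≠ d ∧ ∀ x, t.Edge a x ↔ x = c ∨ x = d)

/-- The only vertices besides connection points are the two bends of the raised strand of a
crossing. -/
lemma Tile.vertexKind_of_mem_segments {t : Tile} {p : Space × Space} (h : p ∈ t.segments) :
    t.VertexKind p.1 ∧ t.VertexKind p.2 := by
  have hW : (∃ s : Side, t.HasPoint s ∧ p.1 = s.midpoint) ∨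
      (t = .crossingHorizontalOver ∧ (p.1 = (-1, 0, 1) ∨ p.1 = (1, 0, 1))) ∨
      (t = .crossingVerticalOver ∧ (p.1 = (0, -1, 1) ∨ p.1 = (0, 1, 1))) := by
    cases t <;> simp only [Tile.segments, Tile.strands, List.map] at h <;>
    fin_cases h <;>
    first
    | exact Or.inl ⟨.west, by simp [Tile.HasPoint, Tile.strands], rfl⟩
    | exact Or.inl ⟨.east, by simp [Tile.HasPoint, Tile.strands], rfl⟩
    | exact Or.inl ⟨.north, by simp [Tile.HasPoint, Tile.strands], rfl⟩
    | exact Or.inl ⟨.south, by simp [Tile.HasPoint, Tile.strands], rfl⟩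
    | simp
  have hE : (∃ s : Side, t.HasPoint s ∧ p.2 = s.midpoint) ∨
      (t = .crossingHorizontalOver ∧ (p.2 = (-1, 0, 1) ∨ p.2 = (1, 0, 1))) ∨
      (t = .crossingVerticalOver ∧ (p.2 = (0, -1, 1) ∨ p.2 = (0, 1, 1))) := by
    cases t <;> simp only [Tile.segments, Tile.strands, List.map] at h <;>
    fin_cases h <;>
    first
    | exact Or.inl ⟨.west, by simp [Tile.HasPoint, Tile.strands], rfl⟩
    | exact Or.inl ⟨.east, by simp [Tile.HasPoint, Tile.strands], rfl⟩
    | exact Or.inl ⟨.north, by simp [Tile.HasPoint, Tile.strands], rfl⟩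
    | exact Or.inl ⟨.south, by simp [Tile.HasPoint, Tile.strands], rfl⟩
    | simp
  have key : ∀ a : Space, ((∃ s : Side, t.HasPoint s ∧ a = s.midpoint) ∨
      (t = .crossingHorizontalOver ∧ (a = (-1, 0, 1) ∨ a = (1, 0, 1))) ∨
      (t = .crossingVerticalOver ∧ (a = (0, -1, 1) ∨ a = (0, 1, 1)))) → t.VertexKind a := by
    rintro a (h | ⟨rfl, rfl | rfl⟩ | ⟨rfl, rfl | rfl⟩)
    · exact Or.inl h
    · refine Or.inr ⟨by norm_num, (1, 0, 1), (-2, 0, 0), by norm_num, fun x => ?_⟩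
      simp only [Tile.Edge, Tile.segments, Side.midpoint, List.mem_cons, Prod.mk.injEq]
      norm_num
    · refine Or.inr ⟨by norm_num, (2, 0, 0), (-1, 0, 1), by norm_num, fun x => ?_⟩
      simp only [Tile.Edge, Tile.segments, Side.midpoint, List.mem_cons, Prod.mk.injEq]
      norm_num
    · refine Or.inr ⟨by norm_num, (0, -2, 0), (0, 1, 1), by norm_num, fun x => ?_⟩
      simp only [Tile.Edge, Tile.segments, Side.midpoint, List.mem_cons, Prod.mk.injEq]
      norm_num
    · refine Or.inr ⟨by norm_num, (0, -1, 1), (0, 2, 0), by norm_num, fun x => ?_⟩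
      simp only [Tile.Edge, Tile.segments, Side.midpoint, List.mem_cons, Prod.mk.injEq]
      norm_num
  exact ⟨key _ hW, key _ hE⟩

lemma Tile.Edge.vertexKind {t : Tile} {a b : Space} (h : t.Edge a b) : t.VertexKind a :=
  h.elim (fun h => (Tile.vertexKind_of_mem_segments h).1)
    fun h => (Tile.vertexKind_of_mem_segments h).2

lemma Tile.eq_of_midpoint_mem {t : Tile} {p : Space × Space} (h : p ∈ t.segments) {s : Side}
    (hs : s.midpoint ∈ segment ℝ p.1 p.2) : s.midpoint = p.1 ∨ s.midpoint = p.2 := by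
  obtain ⟨r, h0, h1, hx, hy, hz⟩ := exists_coord_of_mem_segment hs
  cases t <;> simp only [Tile.segments, Tile.strands, Side.midpoint, List.map] at h <;>
  fin_cases h <;> cases s <;> simp only [Side.midpoint] at hx hy hz ⊢ <;>
  first
  | (exfalso; linarith)
  | norm_num

lemma Tile.Edge.eq_of_midpoint_mem {t : Tile} {a b : Space} (h : t.Edge a b) {s : Side}
    (hs : s.midpoint ∈ segment ℝ a b) : s.midpoint = a ∨ s.midpoint = b := by
  rcases h with h | h
  · exact Tile.eq_of_midpoint_mem h hs
  · rw [segment_symm] at hs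
    exact (Tile.eq_of_midpoint_mem h hs).symm

lemma Tile.disjoint_of_mem_segments {t : Tile} {p q : Space × Space} (h : p ∈ t.segments)
    (h' : q ∈ t.segments) (hne : p ≠ q) {x : Space} (hx : x ∈ segment ℝ p.1 p.2)
    (hx' : x ∈ segment ℝ q.1 q.2) : (x = p.1 ∨ x = p.2) ∧ (x = q.1 ∨ x = q.2) := by
  obtain ⟨r, h0, h1, hx, hy, hz⟩ := exists_coord_of_mem_segment hx
  obtain ⟨s, h0', h1', hx', hy', hz'⟩ := exists_coord_of_mem_segment hx'
  obtain ⟨x1, x2, x3⟩ := x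
  cases t <;> simp only [Tile.segments, Tile.strands, Side.midpoint, List.map] at h h' <;>
  fin_cases h <;> fin_cases h' <;>
  simp only [Prod.mk.injEq] at hx hy hz hx' hy' hz' ⊢ <;>
  -- Distinct segments of one tile meet only when they are consecutive pieces of a raised strand.
  first
  | exact absurd rfl hne
  | (exfalso; linarith)
  | refine ⟨Or.inl ⟨?_, ?_, ?_⟩, Or.inr ⟨?_, ?_, ?_⟩⟩ <;> linarith
  | refine ⟨Or.inr ⟨?_, ?_, ?_⟩, Or.inl ⟨?_, ?_, ?_⟩⟩ <;> linarith

lemma Tile.Edge.disjoint {t : Tile} {a b a' b' : Space} (h : t.Edge a b) (h' : t.Edge a' b')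
    (hne : s(a, b) ≠ s(a', b')) {x : Space} (hx : x ∈ segment ℝ a b) (hx' : x ∈ segment ℝ a' b') :
    (x = a ∨ x = b) ∧ (x = a' ∨ x = b') := by
  have hne1 : (a, b) ≠ (a', b') := fun h => hne (by simp_all)
  have hne2 : (a, b) ≠ (b', a') := fun h => hne (by simp_all)
  have hne3 : (b, a) ≠ (a', b') := fun h => hne (by simp_all)
  have hne4 : (b, a) ≠ (b', a') := fun h => hne (by simp_all)
  have hxs := hx
  have hxs' := hx'
  rw [segment_symm] at hxs hxs'
  rcases h with h | h <;> rcases h' with h' | h'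
  · exact Tile.disjoint_of_mem_segments h h' hne1 hx hx'
  · exact (Tile.disjoint_of_mem_segments h h' hne2 hx hxs').imp_right Or.symm
  · exact (Tile.disjoint_of_mem_segments h h' hne3 hxs hx').imp_left Or.symm
  · exact (Tile.disjoint_of_mem_segments h h' hne4 hxs hxs').imp Or.symm Or.symm

/-! ### Infinite grids of tiles and their graphs -/

/-- The opposite side. -/
def Side.opp : Side → Side
  | .north => .south
  | .east => .west
  | .south => .north
  | .west => .east

/-- The change of the row index when one crosses the side `s`. -/
def Side.di : Side → ℤ
  | .north => -1
  | .south => 1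
  | _ => 0

/-- The change of the column index when one crosses the side `s`. -/
def Side.dj : Side → ℤ
  | .west => -1
  | .east => 1
  | _ => 0

/-- The centre of the tile in row `i` and column `j` of an infinite grid. -/
def ctr (i j : ℤ) : Space := (4 * (j : ℝ), -4 * (i : ℝ), 0)

lemma ctr_add_midpoint (i j : ℤ) (s : Side) :
    ctr i j + s.midpoint = ctr (i + s.di) (j + s.dj) + s.opp.midpoint := by
  cases s <;> simp [ctr, Side.midpoint, Side.di, Side.dj, Side.opp] <;> ring

lemma Side.eq_of_step {s s' : Side} (h1 : s.di = s'.di) (h2 : s.dj = s'.dj) : s = s' := by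
  cases s <;> cases s' <;> simp_all [Side.di, Side.dj]

/-- Octahedra project to the diamonds inscribed in the tiles. Two such diamonds touch at most in the
midpoint of a common side, where the bound by two leaves no room for a nonzero height. -/
lemma eq_midpoint_of_inBall {i j i' j' : ℤ} (hne : ¬ (i = i' ∧ j = j')) {x y : Space}
    (hx : InBall (x - ctr i j)) (hy : InBall (y - ctr i' j')) (hxy : proj x = proj y) :
    x = y ∧ ∃ s : Side, i' = i + s.di ∧ j' = j + s.dj ∧ x = ctr i j + s.midpoint := by
  obtain ⟨x1, x2, x3⟩ := x
  obtain ⟨y1, y2, y3⟩ := y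
  simp only [proj, Prod.mk.injEq] at hxy
  obtain ⟨rfl, rfl⟩ := hxy
  simp only [InBall, ctr, Prod.fst_sub, Prod.snd_sub] at hx hy
  have hx3 := abs_nonneg (x3 - 0)
  have hy3 := abs_nonneg (y3 - 0)
  have h1 : |(4 * (j' : ℝ)) - 4 * j| ≤ |x1 - 4 * j| + |x1 - 4 * j'| := by
    rw [abs_sub_comm x1 (4 * (j' : ℝ)), add_comm]
    exact abs_sub_le _ _ _
  have h2 : |(-4 * (i' : ℝ)) - -4 * i| ≤ |x2 - -4 * i| + |x2 - -4 * i'| := by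
    rw [abs_sub_comm x2 (-4 * (i' : ℝ)), add_comm]
    exact abs_sub_le _ _ _
  have e1 : |(4 * (j' : ℝ)) - 4 * j| = 4 * ((|j' - j| : ℤ) : ℝ) := by
    push_cast
    rw [← mul_sub, abs_mul]; norm_num
  have e2 : |(-4 * (i' : ℝ)) - -4 * i| = 4 * ((|i' - i| : ℤ) : ℝ) := by
    push_cast
    rw [← mul_sub, abs_mul]; norm_num
  -- The centres are at `ℓ¹` distance four times the left side, while the radii add up to four.
  have h3 : |i' - i| + |j' - j| ≤ 1 := by
    have : ((|i' - i| + |j' - j| : ℤ) : ℝ) ≤ 1 := by push_cast at *; linarith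
    exact_mod_cast this
  have hcases : (i' = i + Side.north.di ∧ j' = j + Side.north.dj) ∨
      (i' = i + Side.south.di ∧ j' = j + Side.south.dj) ∨
      (i' = i + Side.west.di ∧ j' = j + Side.west.dj) ∨
      (i' = i + Side.east.di ∧ j' = j + Side.east.dj) := by
    simp only [Side.di, Side.dj]
    grind
  have a1 := le_abs_self (x1 - 4 * j)
  have a2 := neg_abs_le (x1 - 4 * j)
  have a3 := le_abs_self (x1 - 4 * j')
  have a4 := neg_abs_le (x1 - 4 * j')
  have b1 := le_abs_self (x2 - -4 * i)
  have b2 := neg_abs_le (x2 - -4 * i)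
  have b3 := le_abs_self (x2 - -4 * i')
  have b4 := neg_abs_le (x2 - -4 * i')
  have c1 := le_abs_self (x3 - 0)
  have c2 := neg_abs_le (x3 - 0)
  have d1 := le_abs_self (y3 - 0)
  have d2 := neg_abs_le (y3 - 0)
  have p1 := abs_nonneg (x1 - 4 * j)
  have p2 := abs_nonneg (x2 - -4 * i)
  have p3 := abs_nonneg (x1 - 4 * j')
  have p4 := abs_nonneg (x2 - -4 * i')
  rcases hcases with ⟨rfl, rfl⟩ | ⟨rfl, rfl⟩ | ⟨rfl, rfl⟩ | ⟨rfl, rfl⟩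
  · simp only [Side.di, Side.dj] at *
    push_cast at *
    refine ⟨?_, .north, rfl, rfl, ?_⟩ <;>
    simp only [ctr, Side.midpoint, Prod.mk.injEq, Prod.mk_add_mk, true_and] <;>
    (try refine ⟨?_, ?_, ?_⟩) <;> linarith
  · simp only [Side.di, Side.dj] at *
    push_cast at *
    refine ⟨?_, .south, rfl, rfl, ?_⟩ <;>
    simp only [ctr, Side.midpoint, Prod.mk.injEq, Prod.mk_add_mk, true_and] <;>
    (try refine ⟨?_, ?_, ?_⟩) <;> linarith
  · simp only [Side.di, Side.dj] at *
    push_cast at *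
    refine ⟨?_, .west, rfl, rfl, ?_⟩ <;>
    simp only [ctr, Side.midpoint, Prod.mk.injEq, Prod.mk_add_mk, true_and] <;>
    (try refine ⟨?_, ?_, ?_⟩) <;> linarith
  · simp only [Side.di, Side.dj] at *
    push_cast at *
    refine ⟨?_, .east, rfl, rfl, ?_⟩ <;>
    simp only [ctr, Side.midpoint, Prod.mk.injEq, Prod.mk_add_mk, true_and] <;>
    (try refine ⟨?_, ?_, ?_⟩) <;> linarith

/-- The graph drawn by an infinite grid of tiles. -/
def gridGraph (N : ℤ → ℤ → Tile) : SimpleGraph Space where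
  Adj x y := ∃ i j, (N i j).Edge (x - ctr i j) (y - ctr i j)
  symm := ⟨fun _ _ ⟨i, j, h⟩ => ⟨i, j, h.symm⟩⟩
  loopless := ⟨fun _ ⟨_, _, h⟩ => h.ne rfl⟩

/-- Every connection point of every tile of the grid touches one of the contiguous tile. -/
def GridConnected (N : ℤ → ℤ → Tile) : Prop :=
  ∀ i j s, (N i j).HasPoint s → (N (i + s.di) (j + s.dj)).HasPoint s.opp

variable {N : ℤ → ℤ → Tile}

lemma gridGraph_edgesDisjoint (N : ℤ → ℤ → Tile) : EdgesDisjoint (gridGraph N) := by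
  rintro a b a' b' ⟨i, j, h⟩ ⟨i', j', h'⟩ hne x hx hx'
  by_cases hij : i = i' ∧ j = j'
  · obtain ⟨rfl, rfl⟩ := hij
    have := h.disjoint h' (x := x - ctr i j) (by simpa using hne) (sub_mem_segment.2 hx)
      (sub_mem_segment.2 hx')
    simpa using this
  · have hb := h.inBall_of_mem (sub_mem_segment.2 hx)
    have hb' := h'.inBall_of_mem (sub_mem_segment.2 hx')
    obtain ⟨-, s, rfl, rfl, hs⟩ := eq_midpoint_of_inBall hij hb hb' rfl
    have h1 : x - ctr i j = s.midpoint := by rw [hs]; simp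
    have h2 : x - ctr (i + s.di) (j + s.dj) = s.opp.midpoint := by
      rw [hs, ctr_add_midpoint]; simp
    constructor
    · have := h.eq_of_midpoint_mem (s := s) (by rw [← h1]; exact sub_mem_segment.2 hx)
      simpa [← h1] using this
    · have := h'.eq_of_midpoint_mem (s := s.opp) (by rw [← h2]; exact sub_mem_segment.2 hx')
      simpa [← h2] using this

/-- A bend of a raised strand has both neighbours in its tile; a connection point has one neighbour
in each of the two tiles that share it. -/
lemma gridGraph_degree (hN : GridConnected N) (a b : Space) (hab : (gridGraph N).Adj a b) :
    ∃ c d, c ≠ d ∧ ∀ x, (gridGraph N).Adj a x ↔ x = c ∨ x = d := by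
  obtain ⟨i, j, h⟩ := hab
  rcases h.vertexKind with ⟨s, hs, ha⟩ | ⟨hlt, c, d, hcd, hx⟩
  · have ha1 : a = ctr i j + s.midpoint := by rw [← ha]; simp
    have ha2 : a - ctr (i + s.di) (j + s.dj) = s.opp.midpoint := by
      rw [ha1, ctr_add_midpoint]; simp
    have hne : ¬ (i = i + s.di ∧ j = j + s.dj) := by cases s <;> simp [Side.di, Side.dj]
    have h1 : ∀ x, (N i j).Edge (a - ctr i j) (x - ctr i j) ↔
        x = (N i j).arm s + ctr i j := fun x => by
      rw [ha, Tile.edge_midpoint_iff hs, sub_eq_iff_eq_add]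
    have h2 : ∀ x, (N (i + s.di) (j + s.dj)).Edge (a - ctr (i + s.di) (j + s.dj))
        (x - ctr (i + s.di) (j + s.dj)) ↔
        x = (N (i + s.di) (j + s.dj)).arm s.opp + ctr (i + s.di) (j + s.dj) := fun x => by
      rw [ha2, Tile.edge_midpoint_iff (hN i j s hs), sub_eq_iff_eq_add]
    refine ⟨(N i j).arm s + ctr i j,
      (N (i + s.di) (j + s.dj)).arm s.opp + ctr (i + s.di) (j + s.dj), ?_, fun x => ?_⟩
    rotate_left
    · rw [← h1, ← h2]
      constructor
      · rintro ⟨i', j', h'⟩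
        by_cases hij : i = i' ∧ j = j'
        · obtain ⟨rfl, rfl⟩ := hij
          exact Or.inl h'
        · obtain ⟨-, s', rfl, rfl, hs'⟩ := eq_midpoint_of_inBall hij h.inBall h'.inBall rfl
          have : s = s' := by
            have := ha1.symm.trans hs'
            cases s <;> cases s' <;> simp [Side.midpoint] at this ⊢ <;> norm_num at this
          subst this
          exact Or.inr h'
      · rintro (h | h)
        · exact ⟨_, _, h⟩
        · exact ⟨_, _, h⟩
    · intro heq
      have e1 := (h1 _).2 rfl
      have e2 := (h2 _).2 heq
      obtain ⟨-, s', hi, hj, hs'⟩ := eq_midpoint_of_inBall hne e1.symm.inBall e2.symm.inBall rfl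
      have : s = s' := Side.eq_of_step (by linarith) (by linarith)
      subst this
      rw [← ha1] at hs'
      exact e1.ne (by rw [hs'])
  · refine ⟨c + ctr i j, d + ctr i j, by simpa using hcd, fun x => ?_⟩
    rw [← sub_eq_iff_eq_add, ← sub_eq_iff_eq_add, ← hx]
    constructor
    · rintro ⟨i', j', h'⟩
      by_cases hij : i = i' ∧ j = j'
      · obtain ⟨rfl, rfl⟩ := hij
        exact h'
      · obtain ⟨-, s, -, -, hs⟩ := eq_midpoint_of_inBall hij h.inBall h'.inBall rfl
        exfalso
        rw [hs, add_sub_cancel_left] at hlt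
        cases s <;> norm_num [Side.midpoint] at hlt
    · intro h'
      exact ⟨i, j, h'⟩

lemma gridGraph_finite {n : ℕ} (hfin : ∀ i j, N i j ≠ .blank → 0 ≤ i ∧ i < n ∧ 0 ≤ j ∧ j < n) :
    {a | ∃ b, (gridGraph N).Adj a b}.Finite := by
  have hp : {p : ℤ × ℤ | 0 ≤ p.1 ∧ p.1 < n ∧ 0 ≤ p.2 ∧ p.2 < n}.Finite := by
    refine ((Set.finite_Ico (0 : ℤ) n).prod (Set.finite_Ico (0 : ℤ) n)).subset ?_
    rintro ⟨i, j⟩ ⟨h1, h2, h3, h4⟩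
    exact ⟨⟨h1, h2⟩, ⟨h3, h4⟩⟩
  have hs : ∀ p : ℤ × ℤ, {a | ∃ b, (N p.1 p.2).Edge (a - ctr p.1 p.2) b}.Finite := by
    intro p
    refine (List.finite_toSet (((N p.1 p.2).segments.map Prod.fst ++
      (N p.1 p.2).segments.map Prod.snd).map (· + ctr p.1 p.2))).subset ?_
    rintro a ⟨b, h | h⟩ <;> simp only [List.mem_map, List.mem_append, Set.mem_ofPred_eq]
    · exact ⟨_, Or.inl ⟨_, h, rfl⟩, by simp⟩
    · exact ⟨_, Or.inr ⟨_, h, rfl⟩, by simp⟩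
  refine (hp.biUnion fun p _ => hs p).subset ?_
  rintro a ⟨b, i, j, h⟩
  have hb : N i j ≠ .blank := by
    intro h0
    rw [h0] at h
    simp [Tile.Edge, Tile.segments, Tile.strands] at h
  simp only [Set.mem_iUnion]
  exact ⟨(i, j), hfin i j hb, b - ctr i j, h⟩

lemma gridGraph_isPolygon {n : ℕ} (hN : GridConnected N)
    (hfin : ∀ i j, N i j ≠ .blank → 0 ≤ i ∧ i < n ∧ 0 ≤ j ∧ j < n)
    (hne : ∃ a b, (gridGraph N).Adj a b) (hK : IsPreconnected (carrier (gridGraph N))) :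
    IsPolygon (gridGraph N) where
  finite := gridGraph_finite hfin
  degree := gridGraph_degree hN
  disjoint := gridGraph_edgesDisjoint N
  connected S hS a b a' b' := connected_of_isPreconnected (gridGraph_finite hfin)
    (gridGraph_edgesDisjoint N) hK S hS a b a' b'
  nonempty := hne

/-! ### Crossings of a link drawn tile by tile -/

/-- The tile `t` is one of the two crossing tiles. -/
def Tile.IsCrossing (t : Tile) : Prop := t = .crossingHorizontalOver ∨ t = .crossingVerticalOver

/-- Two different points of `L` over the same point of the plane are the two points of a crossing
over the origin. -/
def CrossesOnlyAtOrigin (L : Set Space) : Prop :=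
  ∀ x ∈ L, ∀ y ∈ L, x ≠ y → proj x = proj y →
    (x = 0 ∨ x = (0, 0, 1)) ∧ (y = 0 ∨ y = (0, 0, 1)) ∧
    ∃ u v : Space, segment ℝ (x - u) (x + u) ⊆ L ∧ segment ℝ (y - v) (y + v) ⊆ L ∧
      LinearIndependent ℝ ![proj u, proj v]

/-- Pieces in different octahedra never lie above one another except in a common point, so every
crossing is over the centre of a tile listed in `C`. The pieces are arbitrary sets rather than
tiles, so that the criterion also applies after a kink has been removed from tile `(1, 1)`. -/
lemma diagram_of_pieces {K : Knot} {L : ℤ → ℤ → Set Space} (C : Finset (ℤ × ℤ))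
    (hK : K.carrier = {x | ∃ i j, x - ctr i j ∈ L i j})
    (hball : ∀ i j, ∀ x ∈ L i j, InBall x) (hL : ∀ i j, CrossesOnlyAtOrigin (L i j))
    (hC : ∀ i j, (i, j) ∉ C → ∀ x ∈ L i j, ∀ y ∈ L i j, proj x = proj y → x = y) :
    K.IsDiagram ∧ K.crossings.encard ≤ C.card := by
  have key : ∀ x ∈ K.carrier, ∀ y ∈ K.carrier, x ≠ y → proj x = proj y →
      ∃ i j, (i, j) ∈ C ∧ x - ctr i j ∈ L i j ∧ y - ctr i j ∈ L i j := by
    intro x hx y hy hne hxy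
    rw [hK] at hx hy
    obtain ⟨i, j, hx⟩ := hx
    obtain ⟨i', j', hy⟩ := hy
    by_cases hij : i = i' ∧ j = j'
    · obtain ⟨rfl, rfl⟩ := hij
      refine ⟨i, j, ?_, hx, hy⟩
      by_contra hc
      have := hC i j hc _ hx _ hy (by simp only [proj, Prod.mk.injEq] at hxy; simp [proj, hxy])
      exact hne (by simpa using this)
    · exact absurd (eq_midpoint_of_inBall hij (hball _ _ _ hx) (hball _ _ _ hy) hxy).1 hne
  have key2 : ∀ x ∈ K.carrier, ∀ y ∈ K.carrier, x ≠ y → proj x = proj y →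
      ∃ i j, (i, j) ∈ C ∧ (x = ctr i j ∨ x = (0, 0, 1) + ctr i j) ∧
        (y = ctr i j ∨ y = (0, 0, 1) + ctr i j) ∧
      ∃ u v : Space, segment ℝ (x - u) (x + u) ⊆ K.carrier ∧
        segment ℝ (y - v) (y + v) ⊆ K.carrier ∧ LinearIndependent ℝ ![proj u, proj v] := by
    intro x hx y hy hne hxy
    obtain ⟨i, j, hc, hx', hy'⟩ := key x hx y hy hne hxy
    obtain ⟨h1, h2, u, v, hu, hv, huv⟩ := hL i j _ hx' _ hy' (by simpa using hne)
      (by simp only [proj, Prod.mk.injEq] at hxy; simp [proj, hxy])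
    have hsub : ∀ z w : Space, segment ℝ (z - ctr i j - w) (z - ctr i j + w) ⊆ L i j →
        segment ℝ (z - w) (z + w) ⊆ K.carrier := by
      intro z w h p hp
      rw [hK]
      refine ⟨i, j, h ?_⟩
      rw [sub_right_comm, sub_add_eq_add_sub]
      exact sub_mem_segment.2 hp
    refine ⟨i, j, hc, ?_, ?_, u, v, hsub x u hu, hsub y v hv, huv⟩
    · rwa [sub_eq_zero, sub_eq_iff_eq_add] at h1
    · rwa [sub_eq_zero, sub_eq_iff_eq_add] at h2
  have hproj : ∀ i j, proj ((0, 0, 1) + ctr i j) = proj (ctr i j) := fun i j => by simp [proj, ctr]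
  have hsub : K.crossings ⊆ (C.image fun p => proj (ctr p.1 p.2) : Finset (ℝ × ℝ)) := by
    rintro q ⟨x, hx, y, hy, hne, rfl, hxy⟩
    obtain ⟨i, j, hc, h1, -⟩ := key2 x hx y hy hne hxy.symm
    simp only [Finset.coe_image, Set.mem_image, Finset.mem_coe]
    refine ⟨(i, j), hc, ?_⟩
    rcases h1 with rfl | rfl
    · rfl
    · exact (hproj i j).symm
  refine ⟨⟨(Finset.finite_toSet _).subset hsub, ?_, ?_⟩, ?_⟩
  · intro x hx y hy z hz hxy hyz
    by_contra! hcon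
    obtain ⟨hne, hne', hne''⟩ := hcon
    obtain ⟨i, j, -, h1, h2, -⟩ := key2 x hx y hy hne hxy
    obtain ⟨i', j', -, h1', h2', -⟩ := key2 y hy z hz hne' hyz
    have hctr : ctr i j = ctr i' j' := by
      have : proj (ctr i j) = proj (ctr i' j') := by
        rcases h2 with rfl | rfl <;> rcases h1' with h | h <;>
        simpa [hproj] using congrArg proj h
      simp only [proj, ctr, Prod.mk.injEq] at this ⊢
      simpa using this
    rw [← hctr] at h1' h2'
    -- Only two heights occur over a centre, so two of the three points agree.
    rcases h1 with h1 | h1 <;> rcases h2 with h2 | h2 <;> rcases h2' with h3 | h3 <;>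
    first
    | exact hne (h1.trans h2.symm)
    | exact hne' (h2.trans h3.symm)
    | exact hne'' (h1.trans h3.symm)
  · intro x hx y hy hne hxy
    obtain ⟨-, -, -, -, -, h⟩ := key2 x hx y hy hne hxy
    exact h
  · refine (Set.encard_le_encard hsub).trans ?_
    rw [Set.encard_coe_eq_coe_finsetCard]
    exact_mod_cast Finset.card_image_le

lemma Tile.segment_subset_points {t : Tile} {a b : Space} (h : t.Edge a b) :
    segment ℝ a b ⊆ t.points := fun _ hx => ⟨a, b, h, hx⟩

lemma Tile.inBall_of_mem_points {t : Tile} {x : Space} (hx : x ∈ t.points) : InBall x := by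
  obtain ⟨a, b, h, hx⟩ := hx
  exact h.inBall_of_mem hx

lemma Tile.mem_points_iff {t : Tile} {x : Space} :
    x ∈ t.points ↔ ∃ p ∈ t.segments, x ∈ segment ℝ p.1 p.2 := by
  constructor
  · rintro ⟨a, b, h | h, hx⟩
    · exact ⟨_, h, hx⟩
    · exact ⟨_, h, by rwa [segment_symm]⟩
  · rintro ⟨p, hp, hx⟩
    exact ⟨p.1, p.2, Or.inl hp, hx⟩

lemma Tile.height_eq_zero {t : Tile} (ht : ¬ t.IsCrossing) {x : Space} (hx : x ∈ t.points) :
    x.2.2 = 0 := by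
  obtain ⟨p, hp, hx⟩ := Tile.mem_points_iff.1 hx
  obtain ⟨s, -, -, -, -, hz⟩ := exists_coord_of_mem_segment hx
  rw [hz]
  cases t <;> simp only [Tile.segments, Tile.strands, Side.midpoint, List.map] at hp <;>
  first
  | exact absurd (Or.inl rfl) ht
  | exact absurd (Or.inr rfl) ht
  | (fin_cases hp <;> simp)

lemma Tile.eq_of_proj_eq {t : Tile} (ht : ¬ t.IsCrossing) {x y : Space} (hx : x ∈ t.points)
    (hy : y ∈ t.points) (h : proj x = proj y) : x = y := by
  have h1 := Tile.height_eq_zero ht hx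
  have h2 := Tile.height_eq_zero ht hy
  simp only [proj, Prod.mk.injEq] at h
  exact Prod.ext h.1 (Prod.ext h.2 (h1.trans h2.symm))

/-- The profile of the upper strand of a crossing tile. -/
def Ridge (u z : ℝ) : Prop :=
  (u ≤ -1 ∧ z = 2 + u) ∨ (-1 ≤ u ∧ u ≤ 1 ∧ z = 1) ∨ (1 ≤ u ∧ z = 2 - u)

lemma Ridge.unique {u z z' : ℝ} (h : Ridge u z) (h' : Ridge u z') : z = z' := by
  rcases h with h | h | h <;> rcases h' with h' | h' | h' <;> linarith

lemma Ridge.eq_one {z : ℝ} (h : Ridge 0 z) : z = 1 :=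
  h.unique (Or.inr (Or.inl ⟨by norm_num, by norm_num, rfl⟩))

/-- The points of the crossing tile with horizontal upper strand. -/
lemma Tile.mem_crossingHorizontalOver {x : Space} (hx : x ∈ crossingHorizontalOver.points) :
    (x.2.1 = 0 ∧ Ridge x.1 x.2.2) ∨ (x.1 = 0 ∧ x.2.2 = 0) := by
  obtain ⟨p, hp, hx⟩ := Tile.mem_points_iff.1 hx
  obtain ⟨s, h0, h1, hx, hy, hz⟩ := exists_coord_of_mem_segment hx
  simp only [Tile.segments, Side.midpoint] at hp
  fin_cases hp <;> simp only at hx hy hz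
  · exact Or.inl ⟨by linarith, Or.inl ⟨by linarith, by linarith⟩⟩
  · exact Or.inl ⟨by linarith, Or.inr (Or.inl ⟨by linarith, by linarith, by linarith⟩)⟩
  · exact Or.inl ⟨by linarith, Or.inr (Or.inr ⟨by linarith, by linarith⟩)⟩
  · exact Or.inr ⟨by linarith, by linarith⟩

lemma Tile.mem_crossingVerticalOver {x : Space} (hx : x ∈ crossingVerticalOver.points) :
    (x.1 = 0 ∧ Ridge x.2.1 x.2.2) ∨ (x.2.1 = 0 ∧ x.2.2 = 0) := by
  obtain ⟨p, hp, hx⟩ := Tile.mem_points_iff.1 hx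
  obtain ⟨s, h0, h1, hx, hy, hz⟩ := exists_coord_of_mem_segment hx
  simp only [Tile.segments, Side.midpoint] at hp
  fin_cases hp <;> simp only at hx hy hz
  · exact Or.inl ⟨by linarith, Or.inr (Or.inr ⟨by linarith, by linarith⟩)⟩
  · exact Or.inl ⟨by linarith, Or.inr (Or.inl ⟨by linarith, by linarith, by linarith⟩)⟩
  · exact Or.inl ⟨by linarith, Or.inl ⟨by linarith, by linarith⟩⟩
  · exact Or.inr ⟨by linarith, by linarith⟩

lemma crossesOnlyAtOrigin_of_two {L : Set Space}
    (h : ∀ x ∈ L, ∀ y ∈ L, x ≠ y → proj x = proj y →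
      (x = 0 ∧ y = (0, 0, 1)) ∨ (x = (0, 0, 1) ∧ y = 0))
    (hs : ∃ u v : Space, segment ℝ (0 - u) (0 + u) ⊆ L ∧
      segment ℝ ((0, 0, 1) - v) ((0, 0, 1) + v) ⊆ L ∧ LinearIndependent ℝ ![proj u, proj v]) :
    CrossesOnlyAtOrigin L := by
  obtain ⟨u, v, hu, hv, huv⟩ := hs
  intro x hx y hy hne hxy
  rcases h x hx y hy hne hxy with ⟨rfl, rfl⟩ | ⟨rfl, rfl⟩
  · exact ⟨Or.inl rfl, Or.inr rfl, u, v, hu, hv, huv⟩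
  · exact ⟨Or.inr rfl, Or.inl rfl, v, u, hv, hu, LinearIndependent.pair_symm_iff.1 huv⟩

/-- The strands of a crossing project injectively to the two axes, which meet only at the origin;
there the heights are `0` and `1`. -/
lemma Tile.crossesOnlyAtOrigin (t : Tile) : CrossesOnlyAtOrigin t.points := by
  by_cases ht : t.IsCrossing
  · apply crossesOnlyAtOrigin_of_two
    · rintro ⟨x1, x2, x3⟩ hx ⟨y1, y2, y3⟩ hy hne hxy
      simp only [proj, Prod.mk.injEq] at hxy
      obtain ⟨rfl, rfl⟩ := hxy
      have hne' : x3 ≠ y3 := fun h => hne (by rw [h])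
      rcases ht with rfl | rfl
      · have h1 := Tile.mem_crossingHorizontalOver hx
        have h2 := Tile.mem_crossingHorizontalOver hy
        simp only [Prod.mk_eq_zero, Prod.mk.injEq] at h1 h2 ⊢
        rcases h1 with ⟨rfl, h1⟩ | ⟨rfl, rfl⟩ <;> rcases h2 with ⟨h3, h2⟩ | ⟨h3, h2⟩
        · exact absurd (h1.unique h2) hne'
        · subst h3
          exact Or.inr ⟨⟨rfl, rfl, h1.eq_one⟩, rfl, rfl, h2⟩
        · subst h3
          exact Or.inl ⟨⟨rfl, rfl, rfl⟩, rfl, rfl, h2.eq_one⟩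
        · exact absurd h2.symm hne'
      · have h1 := Tile.mem_crossingVerticalOver hx
        have h2 := Tile.mem_crossingVerticalOver hy
        simp only [Prod.mk_eq_zero, Prod.mk.injEq] at h1 h2 ⊢
        rcases h1 with ⟨rfl, h1⟩ | ⟨rfl, rfl⟩ <;> rcases h2 with ⟨h3, h2⟩ | ⟨h3, h2⟩
        · exact absurd (h1.unique h2) hne'
        · subst h3
          exact Or.inr ⟨⟨rfl, rfl, h1.eq_one⟩, rfl, rfl, h2⟩
        · subst h3
          exact Or.inl ⟨⟨rfl, rfl, rfl⟩, rfl, rfl, h2.eq_one⟩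
        · exact absurd h2.symm hne'
    · rcases ht with rfl | rfl
      -- The straight pieces are the whole lower strand and the flat middle part of the upper one.
      · refine ⟨(0, 2, 0), (1, 0, 0), ?_, ?_, LinearIndependent.pair_iff.2 fun s t h => ?_⟩
        · exact Tile.segment_subset_points (Or.inr (by simp [Tile.segments, Side.midpoint]))
        · exact Tile.segment_subset_points (Or.inl (by simp [Tile.segments]))
        · simpa [proj, and_comm] using h
      · refine ⟨(2, 0, 0), (0, 1, 0), ?_, ?_, LinearIndependent.pair_iff.2 fun s t h => ?_⟩
        · exact Tile.segment_subset_points (Or.inl (by simp [Tile.segments, Side.midpoint]))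
        · exact Tile.segment_subset_points (Or.inr (by simp [Tile.segments]))
        · simpa [proj] using h
  · intro x hx y hy hne hxy
    exact absurd (Tile.eq_of_proj_eq ht hx hy hxy) hne

lemma carrier_gridGraph (N : ℤ → ℤ → Tile) :
    carrier (gridGraph N) = {x | ∃ i j, x - ctr i j ∈ (N i j).points} := by
  ext x
  constructor
  · rintro ⟨a, b, ⟨i, j, h⟩, hx⟩
    exact ⟨i, j, _, _, h, sub_mem_segment.2 hx⟩
  · rintro ⟨i, j, a, b, h, hx⟩
    refine ⟨a + ctr i j, b + ctr i j, ⟨i, j, by simpa using h⟩, ?_⟩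
    rw [← sub_mem_segment (c := ctr i j)]
    simpa using hx

/-! ### Shortcuts by three triangle moves -/

lemma exists_coord_of_mem_triangle {a b c x : Space} (h : x ∈ convexHull ℝ {a, b, c}) :
    ∃ s t : ℝ, 0 ≤ s ∧ 0 ≤ t ∧ s + t ≤ 1 ∧ x.1 = a.1 + s * (b.1 - a.1) + t * (c.1 - a.1) ∧
      x.2.1 = a.2.1 + s * (b.2.1 - a.2.1) + t * (c.2.1 - a.2.1) ∧
      x.2.2 = a.2.2 + s * (b.2.2 - a.2.2) + t * (c.2.2 - a.2.2) := by
  rw [convexHull_insert (by simp), convexHull_pair, mem_convexJoin] at h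
  obtain ⟨a', ha', y, hy, hx⟩ := h
  rw [Set.mem_singleton_iff] at ha'
  subst ha'
  obtain ⟨q, hq0, hq1, h1, h2, h3⟩ := exists_coord_of_mem_segment hy
  obtain ⟨r, hr0, hr1, h4, h5, h6⟩ := exists_coord_of_mem_segment hx
  refine ⟨r * (1 - q), r * q, by nlinarith, by positivity, by nlinarith, ?_, ?_, ?_⟩
  · rw [h4, h1]; ring
  · rw [h5, h2]; ring
  · rw [h6, h3]; ring

/-- The edges of `G` that avoid `c` and the points of `T` meet the triangle `abc` at most in `a`
and `b`. -/
def TriangleFreeOff (G : SimpleGraph Space) (T : Set Space) (a b c : Space) : Prop :=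
  ∀ x y, G.Adj x y → x ∉ T → y ∉ T → x ≠ c → y ≠ c →
    ∀ z ∈ convexHull ℝ {a, b, c}, z ∈ segment ℝ x y → z = a ∨ z = b

/-- Shortening a polygonal arc `a, p, q, r, b` to the segment `ab` by three triangle moves. -/
lemma exists_shortcut {G : SimpleGraph Space} (hG : IsPolygon G) {a p q r b : Space}
    (hap : G.Adj a p) (hpq : G.Adj p q) (hqr : G.Adj q r) (hrb : G.Adj r b)
    (har : a ≠ r) (hbp : b ≠ p) (hbq : b ≠ q)
    (i1 : AffineIndependent ℝ ![a, q, p]) (i2 : AffineIndependent ℝ ![a, r, q])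
    (i3 : AffineIndependent ℝ ![a, b, r]) (t1 : TriangleFreeOff G ∅ a q p)
    (t2 : TriangleFreeOff G {p} a r q) (t3 : TriangleFreeOff G {p, q} a b r) :
    ∃ G' : SimpleGraph Space, IsPolygon G' ∧
      (∀ x y, G'.Adj x y ↔ (G.Adj x y ∧ x ∉ ({p, q, r} : Set Space) ∧
        y ∉ ({p, q, r} : Set Space)) ∨ (x = a ∧ y = b) ∨ (x = b ∧ y = a)) ∧
      ∀ K K' : Knot, K.carrier = carrier G → K'.carrier = carrier G' → K.Equivalent K' := by
  have ne_of : ∀ {x y z : Space}, AffineIndependent ℝ ![x, y, z] → x ≠ y := fun hi h => by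
    have := hi.injective (a₁ := 0) (a₂ := 1) (by simpa using h)
    simp at this
  have haq := ne_of i1
  have hab := ne_of i3
  have f1 : TriangleFree G a q p := fun x y h hx hy => t1 x y h (by simp) (by simp) hx hy
  have b1 := bypass_adj (G := G) (c := p) haq
  have P1 := hG.isPolygon_bypass hap hpq haq f1
  have hrp : r ≠ p := by
    rintro rfl
    rcases (hG.degree_two hap hpq haq b).1 hrb with h | h
    · exact hab h.symm
    · exact hbq h
  -- The edge `aq` created by the first move ends at `q`, the vertex removed next, so only old edges
  -- avoiding `p` need checking. The same holds one move later.
  have f2 : TriangleFree (bypass G a q p) a r q := by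
    intro x y h hx hy
    rcases (b1 x y).1 h with h | ⟨-, rfl⟩ | ⟨rfl, -⟩
    · exact t2 x y h.1 h.2.1 h.2.2 hx hy
    · exact absurd rfl hy
    · exact absurd rfl hx
  have a1 : (bypass G a q p).Adj a q := (b1 _ _).2 (by simp)
  have a2 : (bypass G a q p).Adj q r := (b1 _ _).2 (Or.inl ⟨hqr, hpq.ne', hrp⟩)
  have a3 : (bypass G a q p).Adj r b := (b1 _ _).2 (Or.inl ⟨hrb, hrp, hbp⟩)
  have b2 := bypass_adj (G := bypass G a q p) (c := q) har
  have P2 := P1.isPolygon_bypass a1 a2 har f2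
  have a4 : (bypass (bypass G a q p) a r q).Adj a r := (b2 _ _).2 (by simp)
  have a5 : (bypass (bypass G a q p) a r q).Adj r b := (b2 _ _).2 (Or.inl ⟨a3, hqr.ne', hbq⟩)
  have f3 : TriangleFree (bypass (bypass G a q p) a r q) a b r := by
    intro x y h hx hy
    rcases (b2 x y).1 h with ⟨h, hxq, hyq⟩ | ⟨-, rfl⟩ | ⟨rfl, -⟩
    · rcases (b1 x y).1 h with h | ⟨-, rfl⟩ | ⟨rfl, -⟩
      · exact t3 x y h.1 (by simp [h.2.1, hxq]) (by simp [h.2.2, hyq]) hx hy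
      · exact absurd rfl hyq
      · exact absurd rfl hxq
    · exact absurd rfl hy
    · exact absurd rfl hx
  have b3 := bypass_adj (G := bypass (bypass G a q p) a r q) (c := r) hab
  refine ⟨_, P2.isPolygon_bypass a4 a5 hab f3, fun x y => ?_, fun K K' hK hK' => ?_⟩
  · rw [b3, b2, b1]
    simp only [Set.mem_insert_iff, Set.mem_singleton_iff]
    have := hrb.ne'
    have := hqr.ne
    have := hap.ne
    grind
  · let K1 : Knot := ⟨_, P1.isSimpleClosedPolygon⟩
    let K2 : Knot := ⟨_, P2.isSimpleClosedPolygon⟩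
    have m1 := bypass_triangleMove hG hap hpq i1 f1 hK (K' := K1) rfl
    have m2 := bypass_triangleMove P1 a1 a2 i2 f2 (K := K1) (K' := K2) rfl rfl
    have m3 := bypass_triangleMove P2 a4 a5 i3 f3 (K := K2) rfl hK'
    exact ((Relation.EqvGen.rel _ _ m1).symm.trans _ _ _ (Relation.EqvGen.rel _ _ m2).symm).trans
      _ _ _ (Relation.EqvGen.rel _ _ m3).symm

/-! ### Removing a kink at the north-west corner -/

/-- The position `(i, j)` is one of the four positions at the north-west corner of a mosaic. -/
def AtCorner (i j : ℤ) : Prop := (i = 0 ∨ i = 1) ∧ (j = 0 ∨ j = 1)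

/-- The square around the common corner of the four tiles at the north-west corner. -/
def InCornerSquare (x : Space) : Prop := |x.1 - 2| + |x.2.1 + 2| ≤ 2

/-- The centre of a tile away from the corner is at `ℓ¹` distance at least eight from `(2, -2)`,
more than the sum four of the two radii. Triangles inside the square thus need checking only against
the four corner tiles. -/
lemma not_inCornerSquare {i j : ℤ} (hij : ¬ AtCorner i j) {x : Space} (hx : InBall (x - ctr i j)) :
    ¬ InCornerSquare x := by
  intro hQ
  simp only [InBall, ctr, Prod.fst_sub, Prod.snd_sub] at hx
  unfold InCornerSquare at hQ
  have h0 := abs_nonneg (x.2.2 - 0)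
  have h1 : |(2 : ℝ) - 4 * j| ≤ |x.1 - 2| + |x.1 - 4 * j| := by
    rw [abs_sub_comm x.1 2]
    exact abs_sub_le _ _ _
  have h2 : |(-2 : ℝ) - -4 * i| ≤ |x.2.1 + 2| + |x.2.1 - -4 * i| := by
    have : |x.2.1 + 2| = |(-2 : ℝ) - x.2.1| := by
      rw [abs_sub_comm, sub_neg_eq_add]
    rw [this]
    exact abs_sub_le _ _ _
  have e1 : |(2 : ℝ) - 4 * j| = ((|2 - 4 * j| : ℤ) : ℝ) := by push_cast; rfl
  have e2 : |(-2 : ℝ) - -4 * i| = ((|-2 + 4 * i| : ℤ) : ℝ) := by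
    push_cast; congr 1; ring
  have h3 : |2 - 4 * j| + |-2 + 4 * i| ≤ 4 := by
    have : ((|2 - 4 * j| + |-2 + 4 * i| : ℤ) : ℝ) ≤ 4 := by
      rw [Int.cast_add, ← e1, ← e2]
      linarith
    exact_mod_cast this
  apply hij
  unfold AtCorner
  rcases abs_cases (2 - 4 * j) with ⟨h4, h5⟩ | ⟨h4, h5⟩ <;>
  rcases abs_cases (-2 + 4 * i) with ⟨h6, h7⟩ | ⟨h6, h7⟩ <;> omega

/-- Removing a kink at the north-west corner of a grid. -/
lemma exists_diagram_of_kink {N : ℤ → ℤ → Tile} (hG : IsPolygon (gridGraph N))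
    (C : Finset (ℤ × ℤ)) (hC : ∀ i j, (N i j).IsCrossing → ¬ (i = 1 ∧ j = 1) → (i, j) ∈ C)
    (hcorner : ∀ i j, AtCorner i j → ¬ (i = 1 ∧ j = 1) → ¬ (N i j).IsCrossing)
    {a p q r b : Space}
    (hap : (gridGraph N).Adj a p) (hpq : (gridGraph N).Adj p q) (hqr : (gridGraph N).Adj q r)
    (hrb : (gridGraph N).Adj r b) (har : a ≠ r) (hbp : b ≠ p) (hbq : b ≠ q)
    (i1 : AffineIndependent ℝ ![a, q, p]) (i2 : AffineIndependent ℝ ![a, r, q])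
    (i3 : AffineIndependent ℝ ![a, b, r]) (t1 : TriangleFreeOff (gridGraph N) ∅ a q p)
    (t2 : TriangleFreeOff (gridGraph N) {p} a r q)
    (t3 : TriangleFreeOff (gridGraph N) {p, q} a b r)
    (hp : InCornerSquare p) (hq : InCornerSquare q) (hr : InCornerSquare r)
    (ha : InBall (a - ctr 1 1)) (hb : InBall (b - ctr 1 1))
    (hinj : InjOn proj ({z | ∃ x y, (N 1 1).Edge x y ∧ x ≠ r - ctr 1 1 ∧ y ≠ r - ctr 1 1 ∧
      z ∈ segment ℝ x y} ∪ segment ℝ (a - ctr 1 1) (b - ctr 1 1)))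
    (K : Knot) (hK : K.carrier = carrier (gridGraph N)) :
    ∃ D : Knot, K.Equivalent D ∧ D.IsDiagram ∧ D.crossings.encard ≤ C.card := by
  obtain ⟨G', hG', hadj, hequiv⟩ := exists_shortcut hG hap hpq hqr hrb har hbp hbq i1 i2 i3 t1 t2 t3
  let D : Knot := ⟨carrier G', hG'.isSimpleClosedPolygon⟩
  refine ⟨D, hequiv K D hK rfl, ?_⟩
  have hV : ∀ z ∈ ({p, q, r} : Set Space), InCornerSquare z := by
    rintro z (rfl | rfl | rfl) <;> assumption
  -- `E` is what is left of each tile once `p`, `q`, `r` are gone; `L` adds the new edge `ab` to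
  -- tile `(1, 1)`, which by `hinj` then has no crossing.
  let E : ℤ → ℤ → Set Space := fun i j => {z | ∃ x y, (N i j).Edge x y ∧
    x + ctr i j ∉ ({p, q, r} : Set Space) ∧ y + ctr i j ∉ ({p, q, r} : Set Space) ∧
    z ∈ segment ℝ x y}
  let L : ℤ → ℤ → Set Space := fun i j => E i j ∪
    {z | (i = 1 ∧ j = 1) ∧ z ∈ segment ℝ (a - ctr 1 1) (b - ctr 1 1)}
  have hE : ∀ i j, E i j ⊆ (N i j).points := fun i j z ⟨x, y, h, _, _, hz⟩ => ⟨x, y, h, hz⟩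
  have hL : ∀ i j, ¬ (i = 1 ∧ j = 1) → L i j ⊆ (N i j).points := by
    rintro i j hij z (hz | ⟨h, -⟩)
    · exact hE i j hz
    · exact absurd h hij
  have hL' : ∀ i j, ¬ AtCorner i j → L i j = (N i j).points := by
    intro i j hij
    refine (hL i j fun h => hij (by simp [AtCorner, h])).antisymm ?_
    rintro z ⟨x, y, h, hz⟩
    refine Or.inl ⟨x, y, h, fun hx => ?_, fun hy => ?_, hz⟩
    · exact not_inCornerSquare hij (by simpa using h.inBall) (hV _ hx)
    · exact not_inCornerSquare hij (by simpa using h.symm.inBall) (hV _ hy)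
  have hinj' : InjOn proj (L 1 1) := by
    refine hinj.mono ?_
    rintro z (⟨x, y, h, hx, hy, hz⟩ | ⟨-, hz⟩)
    · refine Or.inl ⟨x, y, h, ?_, ?_, hz⟩
      · rintro rfl
        simp at hx
      · rintro rfl
        simp at hy
    · exact Or.inr hz
  refine diagram_of_pieces (L := L) C ?_ ?_ ?_ ?_
  · ext z
    constructor
    · rintro ⟨x, y, hxy, hz⟩
      rcases (hadj x y).1 hxy with ⟨⟨i, j, h⟩, hx, hy⟩ | ⟨rfl, rfl⟩ | ⟨rfl, rfl⟩
      · exact ⟨i, j, Or.inl ⟨_, _, h, by simpa using hx, by simpa using hy, sub_mem_segment.2 hz⟩⟩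
      · exact ⟨1, 1, Or.inr ⟨⟨rfl, rfl⟩, sub_mem_segment.2 hz⟩⟩
      · rw [segment_symm] at hz
        exact ⟨1, 1, Or.inr ⟨⟨rfl, rfl⟩, sub_mem_segment.2 hz⟩⟩
    · rintro ⟨i, j, ⟨x, y, h, hx, hy, hz⟩ | ⟨⟨rfl, rfl⟩, hz⟩⟩
      · refine ⟨x + ctr i j, y + ctr i j,
          (hadj _ _).2 (Or.inl ⟨⟨i, j, by simpa using h⟩, hx, hy⟩), ?_⟩
        rw [← sub_mem_segment (c := ctr i j)]
        simpa using hz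
      · exact ⟨a, b, (hadj _ _).2 (by simp), sub_mem_segment.1 hz⟩
  · rintro i j z (hz | ⟨-, hz⟩)
    · exact Tile.inBall_of_mem_points (hE i j hz)
    · exact ha.segment hb hz
  · intro i j
    by_cases h1 : i = 1 ∧ j = 1
    · obtain ⟨rfl, rfl⟩ := h1
      intro x hx y hy hne hxy
      exact absurd (hinj' hx hy hxy) hne
    by_cases h2 : AtCorner i j
    · intro x hx y hy hne hxy
      exact absurd (Tile.eq_of_proj_eq (hcorner i j h2 h1) (hL i j h1 hx) (hL i j h1 hy) hxy) hne
    · rw [hL' i j h2]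
      exact Tile.crossesOnlyAtOrigin _
  · intro i j hij x hx y hy hxy
    by_cases h1 : i = 1 ∧ j = 1
    · obtain ⟨rfl, rfl⟩ := h1
      exact hinj' hx hy hxy
    · exact Tile.eq_of_proj_eq (fun h => hij (hC i j h h1)) (hL i j h1 hx) (hL i j h1 hy) hxy

lemma Tile.edge_iff_of_segments {t : Tile} {u v : Space} (h : t.segments = [(u, v)]) (x y : Space) :
    t.Edge x y ↔ (x = u ∧ y = v) ∨ (x = v ∧ y = u) := by
  simp only [Tile.Edge, h, List.mem_singleton, Prod.mk.injEq]
  tauto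

/-- The lower strand is a single segment ending at the north midpoint, so removing that vertex
leaves only the upper strand. -/
lemma Tile.ridge_of_edge_horizontal {x y z : Space} (h : crossingHorizontalOver.Edge x y)
    (hx : x ≠ Side.north.midpoint) (hy : y ≠ Side.north.midpoint) (hz : z ∈ segment ℝ x y) :
    z.2.1 = 0 ∧ Ridge z.1 z.2.2 := by
  have key : ∀ p ∈ crossingHorizontalOver.segments, p.1 ≠ Side.north.midpoint →
      z ∈ segment ℝ p.1 p.2 → z.2.1 = 0 ∧ Ridge z.1 z.2.2 := by
    intro p hp hn hz
    obtain ⟨s, h0, h1, hx, hy, hz⟩ := exists_coord_of_mem_segment hz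
    simp only [Tile.segments, Side.midpoint] at hp
    fin_cases hp <;> simp only at hx hy hz
    · exact ⟨by linarith, Or.inl ⟨by linarith, by linarith⟩⟩
    · exact ⟨by linarith, Or.inr (Or.inl ⟨by linarith, by linarith, by linarith⟩)⟩
    · exact ⟨by linarith, Or.inr (Or.inr ⟨by linarith, by linarith⟩)⟩
    · exact absurd rfl hn
  rcases h with h | h
  · exact key _ h hx hz
  · rw [segment_symm] at hz
    exact key _ h hy hz

lemma Tile.ridge_of_edge_vertical {x y z : Space} (h : crossingVerticalOver.Edge x y)
    (hx : x ≠ Side.west.midpoint) (hy : y ≠ Side.west.midpoint) (hz : z ∈ segment ℝ x y) :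
    z.1 = 0 ∧ Ridge z.2.1 z.2.2 := by
  have key : ∀ p ∈ crossingVerticalOver.segments, p.1 ≠ Side.west.midpoint →
      z ∈ segment ℝ p.1 p.2 → z.1 = 0 ∧ Ridge z.2.1 z.2.2 := by
    intro p hp hn hz
    obtain ⟨s, h0, h1, hx, hy, hz⟩ := exists_coord_of_mem_segment hz
    simp only [Tile.segments, Side.midpoint] at hp
    fin_cases hp <;> simp only at hx hy hz
    · exact ⟨by linarith, Or.inr (Or.inr ⟨by linarith, by linarith⟩)⟩
    · exact ⟨by linarith, Or.inr (Or.inl ⟨by linarith, by linarith, by linarith⟩)⟩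
    · exact ⟨by linarith, Or.inl ⟨by linarith, by linarith⟩⟩
    · exact absurd rfl hn
  rcases h with h | h
  · exact key _ h hx hz
  · rw [segment_symm] at hz
    exact key _ h hy hz

lemma Ridge.of_eq_zero {u z : ℝ} (h : Ridge u z) (hz : z = 0) : u = -2 ∨ u = 2 := by
  rcases h with h | h | h
  · left; linarith
  · linarith
  · right; linarith

lemma ctr_one_one : ctr 1 1 = (4, -4, 0) := by simp [ctr]

lemma space_ext {x : Space} {u v w : ℝ} (h1 : x.1 = u) (h2 : x.2.1 = v) (h3 : x.2.2 = w) :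
    x = (u, v, w) := Prod.ext h1 (Prod.ext h2 h3)

lemma inCornerSquare_of_triangle {a b c z : Space} (ha : InCornerSquare a) (hb : InCornerSquare b)
    (hc : InCornerSquare c) (hz : z ∈ convexHull ℝ {a, b, c}) : InCornerSquare z := by
  have hconv : Convex ℝ {z : Space | InCornerSquare z} := by
    intro x hx y hy r s hr hs hrs
    simp only [Set.mem_ofPred_eq, InCornerSquare, Prod.fst_add, Prod.smul_fst, Prod.snd_add,
      Prod.smul_snd, smul_eq_mul] at *
    have key : ∀ p q d : ℝ, |r * p + s * q + d| ≤ r * |p + d| + s * |q + d| := fun p q d => by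
      have : r * p + s * q + d = r * (p + d) + s * (q + d) := by linear_combination (-d) * hrs
      rw [this]
      refine (abs_add_le _ _).trans ?_
      rw [abs_mul, abs_mul, abs_of_nonneg hr, abs_of_nonneg hs]
    have h1 := key x.1 y.1 (-2)
    have h2 := key x.2.1 y.2.1 2
    simp only [← sub_eq_add_neg] at h1
    have h4 := mul_le_mul_of_nonneg_left hx hr
    have h5 := mul_le_mul_of_nonneg_left hy hs
    have h6 : r * 2 + s * 2 = 2 := by linarith
    linarith
  refine convexHull_min ?_ hconv hz
  rintro x (rfl | rfl | rfl) <;> assumption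

/-- The tiles of a kink at the north-west corner. -/
structure KinkCorner (N : ℤ → ℤ → Tile) : Prop where
  tile00 : N 0 0 = .arcSE
  tile01 : N 0 1 = .arcWS
  tile10 : N 1 0 = .arcEN

lemma KinkCorner.edge00 (h : KinkCorner N) (x y : Space) :
    (N 0 0).Edge (x - ctr 0 0) (y - ctr 0 0) ↔
      (x = (0, -2, 0) ∧ y = (2, 0, 0)) ∨ (x = (2, 0, 0) ∧ y = (0, -2, 0)) := by
  rw [h.tile00, Tile.edge_iff_of_segments (u := Side.south.midpoint) (v := Side.east.midpoint) rfl]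
  simp [sub_eq_iff_eq_add, ctr, Side.midpoint]

lemma KinkCorner.edge01 (h : KinkCorner N) (x y : Space) :
    (N 0 1).Edge (x - ctr 0 1) (y - ctr 0 1) ↔
      (x = (2, 0, 0) ∧ y = (4, -2, 0)) ∨ (x = (4, -2, 0) ∧ y = (2, 0, 0)) := by
  rw [h.tile01, Tile.edge_iff_of_segments (u := Side.west.midpoint) (v := Side.south.midpoint) rfl]
  norm_num [sub_eq_iff_eq_add, ctr, Side.midpoint]

lemma KinkCorner.edge10 (h : KinkCorner N) (x y : Space) :
    (N 1 0).Edge (x - ctr 1 0) (y - ctr 1 0) ↔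
      (x = (2, -4, 0) ∧ y = (0, -2, 0)) ∨ (x = (0, -2, 0) ∧ y = (2, -4, 0)) := by
  rw [h.tile10, Tile.edge_iff_of_segments (u := Side.east.midpoint) (v := Side.north.midpoint) rfl]
  norm_num [sub_eq_iff_eq_add, ctr, Side.midpoint]

lemma KinkCorner.not_isCrossing (h : KinkCorner N) {i j : ℤ} (hij : AtCorner i j)
    (h1 : ¬ (i = 1 ∧ j = 1)) : ¬ (N i j).IsCrossing := by
  obtain ⟨rfl | rfl, rfl | rfl⟩ := hij
  · simp [h.tile00, Tile.IsCrossing]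
  · simp [h.tile01, Tile.IsCrossing]
  · simp [h.tile10, Tile.IsCrossing]
  · simp at h1

/-- The part of the grid outside the north-west corner meets the tile `(1, 1)` only at the
midpoints of its east and south sides. -/
lemma eq_of_not_atCorner {i j : ℤ} (hij : ¬ AtCorner i j) {z : Space}
    (h : InBall (z - ctr i j)) (h' : InBall (z - ctr 1 1)) : z = (6, -4, 0) ∨ z = (4, -6, 0) := by
  have hne : ¬ ((1 : ℤ) = i ∧ (1 : ℤ) = j) := by
    rintro ⟨rfl, rfl⟩
    simp [AtCorner] at hij
  obtain ⟨-, s, rfl, rfl, hz⟩ := eq_midpoint_of_inBall hne h' h rfl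
  rw [hz, ctr_one_one]
  cases s <;> simp [AtCorner, Side.di, Side.dj] at hij <;> norm_num [Side.midpoint]

/-- The loop `a, p, q, r` and the lower strand `rb` of tile `(1, 1)` all lie at height zero. They
are pulled flat under the upper strand to the segment from the west midpoint `a` to the south
midpoint `b`, which meets the upper strand only in `a`. -/
lemma exists_diagram_of_kink_horizontal (h : KinkCorner N) (h11 : N 1 1 = .crossingHorizontalOver)
    (hG : IsPolygon (gridGraph N)) (C : Finset (ℤ × ℤ))
    (hC : ∀ i j, (N i j).IsCrossing → ¬ (i = 1 ∧ j = 1) → (i, j) ∈ C)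
    (K : Knot) (hK : K.carrier = carrier (gridGraph N)) :
    ∃ D : Knot, K.Equivalent D ∧ D.IsDiagram ∧ D.crossings.encard ≤ C.card := by
  have qa : InCornerSquare (2, -4, 0) := by norm_num [InCornerSquare]
  have qp : InCornerSquare (0, -2, 0) := by norm_num [InCornerSquare]
  have qq : InCornerSquare (2, 0, 0) := by norm_num [InCornerSquare]
  have qr : InCornerSquare (4, -2, 0) := by norm_num [InCornerSquare]
  have ba : InBall ((2, -4, 0) - ctr 1 1) := by norm_num [InBall, ctr_one_one]
  have bb : InBall ((4, -6, 0) - ctr 1 1) := by norm_num [InBall, ctr_one_one]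
  refine exists_diagram_of_kink hG C hC (fun i j => h.not_isCrossing) (a := (2, -4, 0))
    (p := (0, -2, 0)) (q := (2, 0, 0)) (r := (4, -2, 0)) (b := (4, -6, 0))
    ⟨1, 0, (h.edge10 _ _).2 (by simp)⟩ ⟨0, 0, (h.edge00 _ _).2 (by simp)⟩
    ⟨0, 1, (h.edge01 _ _).2 (by simp)⟩ ⟨1, 1, ?_⟩ (by norm_num) (by norm_num) (by norm_num)
    ?_ ?_ ?_ ?_ ?_ ?_ qp qq qr ba bb ?_ K hK
  · rw [h11, ctr_one_one]
    norm_num [Tile.Edge, Tile.segments, Side.midpoint]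
  · refine affineIndependent_triple fun s t hst => ?_
    simp only [Prod.mk_sub_mk, Prod.smul_mk, Prod.mk_add_mk, Prod.mk_eq_zero, smul_eq_mul] at hst
    constructor <;> linarith
  · refine affineIndependent_triple fun s t hst => ?_
    simp only [Prod.mk_sub_mk, Prod.smul_mk, Prod.mk_add_mk, Prod.mk_eq_zero, smul_eq_mul] at hst
    constructor <;> linarith
  · refine affineIndependent_triple fun s t hst => ?_
    simp only [Prod.mk_sub_mk, Prod.smul_mk, Prod.mk_add_mk, Prod.mk_eq_zero, smul_eq_mul] at hst
    constructor <;> linarith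
  · rintro x y ⟨i, j, hxy⟩ - - hx hy z hz hzs
    by_cases hij : AtCorner i j
    · obtain ⟨s, t, hs, ht, hst, e1, e2, e3⟩ := exists_coord_of_mem_triangle hz
      simp only at e1 e2 e3
      obtain ⟨rfl | rfl, rfl | rfl⟩ := hij
      · rcases (h.edge00 _ _).1 hxy with ⟨rfl, rfl⟩ | ⟨rfl, rfl⟩ <;> contradiction
      · have hz1 : z.1 = 2 ∧ z.2.1 = 0 ∧ z.2.2 = 0 := by
          rcases (h.edge01 _ _).1 hxy with ⟨rfl, rfl⟩ | ⟨rfl, rfl⟩ <;>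
          obtain ⟨u, hu0, hu1, d1, d2, d3⟩ := exists_coord_of_mem_segment hzs <;>
          simp only at d1 d2 d3 <;> refine ⟨?_, ?_, ?_⟩ <;> linarith
        exact Or.inr (space_ext hz1.1 hz1.2.1 hz1.2.2)
      · rcases (h.edge10 _ _).1 hxy with ⟨rfl, rfl⟩ | ⟨rfl, rfl⟩ <;> contradiction
      · rw [h11] at hxy
        have := Tile.mem_crossingHorizontalOver ⟨_, _, hxy, sub_mem_segment.2 hzs⟩
        simp only [ctr_one_one, Prod.fst_sub, Prod.snd_sub] at this
        rcases this with ⟨f, -⟩ | ⟨f, -⟩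
        · exact Or.inl (space_ext (by linarith) (by linarith) (by linarith))
        · exfalso; linarith
    · exact absurd (inCornerSquare_of_triangle qa qq qp hz)
        (not_inCornerSquare hij (hxy.inBall_of_mem (sub_mem_segment.2 hzs)))
  · rintro x y ⟨i, j, hxy⟩ hxT hyT hx hy z hz hzs
    by_cases hij : AtCorner i j
    · obtain ⟨s, t, hs, ht, hst, e1, e2, e3⟩ := exists_coord_of_mem_triangle hz
      simp only at e1 e2 e3
      obtain ⟨rfl | rfl, rfl | rfl⟩ := hij
      · rcases (h.edge00 _ _).1 hxy with ⟨rfl, rfl⟩ | ⟨rfl, rfl⟩ <;> contradiction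
      · rcases (h.edge01 _ _).1 hxy with ⟨rfl, rfl⟩ | ⟨rfl, rfl⟩ <;> contradiction
      · rcases (h.edge10 _ _).1 hxy with ⟨rfl, rfl⟩ | ⟨rfl, rfl⟩ <;> simp at hxT hyT
      · rw [h11] at hxy
        have := Tile.mem_crossingHorizontalOver ⟨_, _, hxy, sub_mem_segment.2 hzs⟩
        simp only [ctr_one_one, Prod.fst_sub, Prod.snd_sub] at this
        rcases this with ⟨f, -⟩ | ⟨f, -⟩
        · exact Or.inl (space_ext (by linarith) (by linarith) (by linarith))
        · exact Or.inr (space_ext (by linarith) (by linarith) (by linarith))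
    · exact absurd (inCornerSquare_of_triangle qa qr qq hz)
        (not_inCornerSquare hij (hxy.inBall_of_mem (sub_mem_segment.2 hzs)))
  · rintro x y ⟨i, j, hxy⟩ hxT hyT hx hy z hz hzs
    obtain ⟨s, t, hs, ht, hst, e1, e2, e3⟩ := exists_coord_of_mem_triangle hz
    simp only at e1 e2 e3
    by_cases hij : AtCorner i j
    · obtain ⟨rfl | rfl, rfl | rfl⟩ := hij
      · rcases (h.edge00 _ _).1 hxy with ⟨rfl, rfl⟩ | ⟨rfl, rfl⟩ <;> simp at hxT hyT
      · rcases (h.edge01 _ _).1 hxy with ⟨rfl, rfl⟩ | ⟨rfl, rfl⟩ <;> contradiction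
      · rcases (h.edge10 _ _).1 hxy with ⟨rfl, rfl⟩ | ⟨rfl, rfl⟩ <;> simp at hxT hyT
      · rw [h11] at hxy
        have hn : ∀ w : Space, w ≠ (4, -2, 0) → w - ctr 1 1 ≠ Side.north.midpoint := by
          intro w hw hw'
          apply hw
          rw [sub_eq_iff_eq_add.1 hw', ctr_one_one]
          norm_num [Side.midpoint]
        obtain ⟨f, g⟩ := Tile.ridge_of_edge_horizontal hxy (hn x hx) (hn y hy)
          (sub_mem_segment.2 hzs)
        simp only [ctr_one_one, Prod.fst_sub, Prod.snd_sub] at f g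
        -- The upper strand has height zero only at its ends: the west one is `a`, the east one is
        -- outside the triangle.
        rcases g.of_eq_zero (by linarith) with g | g
        · exact Or.inl (space_ext (by linarith) (by linarith) (by linarith))
        · exfalso; linarith
    -- The third triangle leaves the corner square but stays in the octahedron of tile `(1, 1)`.
    · have hzb : InBall (z - ctr 1 1) := by
        simp only [InBall, ctr_one_one, Prod.fst_sub, Prod.snd_sub]
        rw [abs_of_nonpos (by linarith), show z.2.2 - 0 = 0 by linarith, abs_zero]
        rcases abs_cases (z.2.1 - -4) with ⟨h1, -⟩ | ⟨h1, -⟩ <;> rw [h1] <;> linarith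
      rcases eq_of_not_atCorner hij (hxy.inBall_of_mem (sub_mem_segment.2 hzs)) hzb with rfl | rfl
      · exfalso
        simp only at e1
        linarith
      · exact Or.inr rfl
  · have hpts : ∀ z ∈ ({z | ∃ x y, (N 1 1).Edge x y ∧ x ≠ (4, -2, 0) - ctr 1 1 ∧
        y ≠ (4, -2, 0) - ctr 1 1 ∧ z ∈ segment ℝ x y} ∪
        segment ℝ ((2, -4, 0) - ctr 1 1) ((4, -6, 0) - ctr 1 1)),
        (z.2.1 = 0 ∧ Ridge z.1 z.2.2) ∨ (z.1 + z.2.1 = -2 ∧ z.2.2 = 0) := by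
      have hr : ((4, -2, 0) : Space) - ctr 1 1 = Side.north.midpoint := by
        rw [ctr_one_one]; norm_num [Side.midpoint]
      rw [hr, h11]
      rintro z (⟨x, y, hxy, hx, hy, hz⟩ | hz)
      · exact Or.inl (Tile.ridge_of_edge_horizontal hxy hx hy hz)
      · obtain ⟨u, hu0, hu1, d1, d2, d3⟩ := exists_coord_of_mem_segment hz
        simp only [ctr_one_one, Prod.fst_sub, Prod.snd_sub] at d1 d2 d3
        exact Or.inr ⟨by linarith, by linarith⟩
    intro z hz w hw hzw
    simp only [proj, Prod.mk.injEq] at hzw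
    refine Prod.ext hzw.1 (Prod.ext hzw.2 ?_)
    rcases hpts z hz with ⟨f, g⟩ | ⟨f, g⟩ <;> rcases hpts w hw with ⟨f', g'⟩ | ⟨f', g'⟩
    · rw [← hzw.1] at g'
      exact g.unique g'
    -- The projected segment `ab` meets the axis of the upper strand only at its west end, where
    -- that strand too has height zero.
    · rw [g']
      rw [hzw.1, show w.1 = -2 by linarith] at g
      rcases g with g | g | g <;> linarith
    · rw [g]
      rw [show w.1 = -2 by linarith] at g'
      rcases g' with g' | g' | g' <;> linarith
    · rw [g, g']

/-- Mirror image of the horizontal case in the diagonal of the mosaic: the loop is now run through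
from the north midpoint, and the lower strand goes from west to east. -/
lemma exists_diagram_of_kink_vertical (h : KinkCorner N) (h11 : N 1 1 = .crossingVerticalOver)
    (hG : IsPolygon (gridGraph N)) (C : Finset (ℤ × ℤ))
    (hC : ∀ i j, (N i j).IsCrossing → ¬ (i = 1 ∧ j = 1) → (i, j) ∈ C)
    (K : Knot) (hK : K.carrier = carrier (gridGraph N)) :
    ∃ D : Knot, K.Equivalent D ∧ D.IsDiagram ∧ D.crossings.encard ≤ C.card := by
  have qa : InCornerSquare (4, -2, 0) := by norm_num [InCornerSquare]
  have qp : InCornerSquare (2, 0, 0) := by norm_num [InCornerSquare]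
  have qq : InCornerSquare (0, -2, 0) := by norm_num [InCornerSquare]
  have qr : InCornerSquare (2, -4, 0) := by norm_num [InCornerSquare]
  have ba : InBall ((4, -2, 0) - ctr 1 1) := by norm_num [InBall, ctr_one_one]
  have bb : InBall ((6, -4, 0) - ctr 1 1) := by norm_num [InBall, ctr_one_one]
  refine exists_diagram_of_kink hG C hC (fun i j => h.not_isCrossing) (a := (4, -2, 0))
    (p := (2, 0, 0)) (q := (0, -2, 0)) (r := (2, -4, 0)) (b := (6, -4, 0))
    ⟨0, 1, (h.edge01 _ _).2 (by simp)⟩ ⟨0, 0, (h.edge00 _ _).2 (by simp)⟩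
    ⟨1, 0, (h.edge10 _ _).2 (by simp)⟩ ⟨1, 1, ?_⟩ (by norm_num) (by norm_num) (by norm_num)
    ?_ ?_ ?_ ?_ ?_ ?_ qp qq qr ba bb ?_ K hK
  · rw [h11, ctr_one_one]
    norm_num [Tile.Edge, Tile.segments, Side.midpoint]
    rfl
  · refine affineIndependent_triple fun s t hst => ?_
    simp only [Prod.mk_sub_mk, Prod.smul_mk, Prod.mk_add_mk, Prod.mk_eq_zero, smul_eq_mul] at hst
    constructor <;> linarith
  · refine affineIndependent_triple fun s t hst => ?_
    simp only [Prod.mk_sub_mk, Prod.smul_mk, Prod.mk_add_mk, Prod.mk_eq_zero, smul_eq_mul] at hst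
    constructor <;> linarith
  · refine affineIndependent_triple fun s t hst => ?_
    simp only [Prod.mk_sub_mk, Prod.smul_mk, Prod.mk_add_mk, Prod.mk_eq_zero, smul_eq_mul] at hst
    constructor <;> linarith
  · rintro x y ⟨i, j, hxy⟩ - - hx hy z hz hzs
    by_cases hij : AtCorner i j
    · obtain ⟨s, t, hs, ht, hst, e1, e2, e3⟩ := exists_coord_of_mem_triangle hz
      simp only at e1 e2 e3
      obtain ⟨rfl | rfl, rfl | rfl⟩ := hij
      · rcases (h.edge00 _ _).1 hxy with ⟨rfl, rfl⟩ | ⟨rfl, rfl⟩ <;> contradiction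
      · rcases (h.edge01 _ _).1 hxy with ⟨rfl, rfl⟩ | ⟨rfl, rfl⟩ <;> contradiction
      · have hz1 : z.1 = 0 ∧ z.2.1 = -2 ∧ z.2.2 = 0 := by
          rcases (h.edge10 _ _).1 hxy with ⟨rfl, rfl⟩ | ⟨rfl, rfl⟩ <;>
          obtain ⟨u, hu0, hu1, d1, d2, d3⟩ := exists_coord_of_mem_segment hzs <;>
          simp only at d1 d2 d3 <;> refine ⟨?_, ?_, ?_⟩ <;> linarith
        exact Or.inr (space_ext hz1.1 hz1.2.1 hz1.2.2)
      · rw [h11] at hxy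
        have := Tile.mem_crossingVerticalOver ⟨_, _, hxy, sub_mem_segment.2 hzs⟩
        simp only [ctr_one_one, Prod.fst_sub, Prod.snd_sub] at this
        rcases this with ⟨f, -⟩ | ⟨f, -⟩
        · exact Or.inl (space_ext (by linarith) (by linarith) (by linarith))
        · exfalso; linarith
    · exact absurd (inCornerSquare_of_triangle qa qq qp hz)
        (not_inCornerSquare hij (hxy.inBall_of_mem (sub_mem_segment.2 hzs)))
  · rintro x y ⟨i, j, hxy⟩ hxT hyT hx hy z hz hzs
    by_cases hij : AtCorner i j
    · obtain ⟨s, t, hs, ht, hst, e1, e2, e3⟩ := exists_coord_of_mem_triangle hz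
      simp only at e1 e2 e3
      obtain ⟨rfl | rfl, rfl | rfl⟩ := hij
      · rcases (h.edge00 _ _).1 hxy with ⟨rfl, rfl⟩ | ⟨rfl, rfl⟩ <;> contradiction
      · rcases (h.edge01 _ _).1 hxy with ⟨rfl, rfl⟩ | ⟨rfl, rfl⟩ <;> simp at hxT hyT
      · rcases (h.edge10 _ _).1 hxy with ⟨rfl, rfl⟩ | ⟨rfl, rfl⟩ <;> contradiction
      · rw [h11] at hxy
        have := Tile.mem_crossingVerticalOver ⟨_, _, hxy, sub_mem_segment.2 hzs⟩
        simp only [ctr_one_one, Prod.fst_sub, Prod.snd_sub] at this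
        rcases this with ⟨f, -⟩ | ⟨f, -⟩
        · exact Or.inl (space_ext (by linarith) (by linarith) (by linarith))
        · exact Or.inr (space_ext (by linarith) (by linarith) (by linarith))
    · exact absurd (inCornerSquare_of_triangle qa qr qq hz)
        (not_inCornerSquare hij (hxy.inBall_of_mem (sub_mem_segment.2 hzs)))
  · rintro x y ⟨i, j, hxy⟩ hxT hyT hx hy z hz hzs
    obtain ⟨s, t, hs, ht, hst, e1, e2, e3⟩ := exists_coord_of_mem_triangle hz
    simp only at e1 e2 e3
    by_cases hij : AtCorner i j
    · obtain ⟨rfl | rfl, rfl | rfl⟩ := hij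
      · rcases (h.edge00 _ _).1 hxy with ⟨rfl, rfl⟩ | ⟨rfl, rfl⟩ <;> simp at hxT hyT
      · rcases (h.edge01 _ _).1 hxy with ⟨rfl, rfl⟩ | ⟨rfl, rfl⟩ <;> simp at hxT hyT
      · rcases (h.edge10 _ _).1 hxy with ⟨rfl, rfl⟩ | ⟨rfl, rfl⟩ <;> contradiction
      · rw [h11] at hxy
        have hn : ∀ w : Space, w ≠ (2, -4, 0) → w - ctr 1 1 ≠ Side.west.midpoint := by
          intro w hw hw'
          apply hw
          rw [sub_eq_iff_eq_add.1 hw', ctr_one_one]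
          norm_num [Side.midpoint]
        obtain ⟨f, g⟩ := Tile.ridge_of_edge_vertical hxy (hn x hx) (hn y hy)
          (sub_mem_segment.2 hzs)
        simp only [ctr_one_one, Prod.fst_sub, Prod.snd_sub] at f g
        rcases g.of_eq_zero (by linarith) with g | g
        · exfalso; linarith
        · exact Or.inl (space_ext (by linarith) (by linarith) (by linarith))
    · have hzb : InBall (z - ctr 1 1) := by
        simp only [InBall, ctr_one_one, Prod.fst_sub, Prod.snd_sub]
        rw [abs_of_nonneg (show 0 ≤ z.2.1 - -4 by linarith), show z.2.2 - 0 = 0 by linarith,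
          abs_zero]
        rcases abs_cases (z.1 - 4) with ⟨h1, -⟩ | ⟨h1, -⟩ <;> rw [h1] <;> linarith
      rcases eq_of_not_atCorner hij (hxy.inBall_of_mem (sub_mem_segment.2 hzs)) hzb with rfl | rfl
      · exact Or.inr rfl
      · exfalso
        simp only at e2
        linarith
  · have hpts : ∀ z ∈ ({z | ∃ x y, (N 1 1).Edge x y ∧ x ≠ (2, -4, 0) - ctr 1 1 ∧
        y ≠ (2, -4, 0) - ctr 1 1 ∧ z ∈ segment ℝ x y} ∪
        segment ℝ ((4, -2, 0) - ctr 1 1) ((6, -4, 0) - ctr 1 1)),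
        (z.1 = 0 ∧ Ridge z.2.1 z.2.2) ∨ (z.1 + z.2.1 = 2 ∧ z.2.2 = 0) := by
      have hr : ((2, -4, 0) : Space) - ctr 1 1 = Side.west.midpoint := by
        rw [ctr_one_one]; norm_num [Side.midpoint]; rfl
      rw [hr, h11]
      rintro z (⟨x, y, hxy, hx, hy, hz⟩ | hz)
      · exact Or.inl (Tile.ridge_of_edge_vertical hxy hx hy hz)
      · obtain ⟨u, hu0, hu1, d1, d2, d3⟩ := exists_coord_of_mem_segment hz
        simp only [ctr_one_one, Prod.fst_sub, Prod.snd_sub] at d1 d2 d3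
        exact Or.inr ⟨by linarith, by linarith⟩
    intro z hz w hw hzw
    simp only [proj, Prod.mk.injEq] at hzw
    refine Prod.ext hzw.1 (Prod.ext hzw.2 ?_)
    rcases hpts z hz with ⟨f, g⟩ | ⟨f, g⟩ <;> rcases hpts w hw with ⟨f', g'⟩ | ⟨f', g'⟩
    · rw [← hzw.2] at g'
      exact g.unique g'
    · rw [g']
      rw [hzw.2, show w.2.1 = 2 by linarith] at g
      rcases g with g | g | g <;> linarith
    · rw [g]
      rw [show w.2.1 = 2 by linarith] at g'
      rcases g' with g' | g' | g' <;> linarith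
    · rw [g, g']

/-! ### Combinatorics of full grids -/

lemma GridConnected.east_iff (hN : GridConnected N) (i j : ℤ) :
    (N i j).HasPoint .east ↔ (N i (j + 1)).HasPoint .west := by
  constructor
  · intro h
    simpa [Side.di, Side.dj, Side.opp] using hN i j .east h
  · intro h
    simpa [Side.di, Side.dj, Side.opp] using hN i (j + 1) .west h

lemma GridConnected.south_iff (hN : GridConnected N) (i j : ℤ) :
    (N i j).HasPoint .south ↔ (N (i + 1) j).HasPoint .north := by
  constructor
  · intro h
    simpa [Side.di, Side.dj, Side.opp] using hN i j .south h
  · intro h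
    simpa [Side.di, Side.dj, Side.opp] using hN (i + 1) j .north h

lemma Tile.not_hasPoint_blank (s : Side) : ¬ Tile.blank.HasPoint s := by
  simp [Tile.HasPoint, Tile.strands]

lemma Tile.IsCrossing.hasPoint {t : Tile} (ht : t.IsCrossing) (s : Side) : t.HasPoint s := by
  rcases ht with rfl | rfl <;> cases s <;> simp [Tile.HasPoint, Tile.strands]

/-- Strands go straight through a crossing, so one that starts on the east-west axis stays on it.
This keeps the component in `IsMosaicGrid.not_isPolygon` inside its rows. -/
lemma Tile.IsCrossing.edge_height {t : Tile} (ht : t.IsCrossing) {a b : Space} (h : t.Edge a b)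
    (ha : a.2.1 = 0) : b.2.1 = 0 := by
  rcases ht with rfl | rfl <;> rcases h with h | h <;>
  simp only [Tile.segments, Side.midpoint, List.mem_cons, Prod.mk.injEq, List.not_mem_nil,
    or_false] at h <;> rcases h with ⟨rfl, rfl⟩ | ⟨rfl, rfl⟩ | ⟨rfl, rfl⟩ | ⟨rfl, rfl⟩ <;>
  first
  | (norm_num at ha; done)
  | norm_num

section tiles

variable (t : Tile)

lemma Tile.eq_of_south (h1 : ¬ t.HasPoint .north) (h2 : t.HasPoint .south) :
    t = arcWS ∨ t = arcSE := by
  revert h1 h2; cases t <;> simp [Tile.HasPoint, Tile.strands]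

lemma Tile.eq_arcWS (h1 : ¬ t.HasPoint .north) (h2 : ¬ t.HasPoint .east) (h3 : t.HasPoint .west) :
    t = arcWS := by
  revert h1 h2 h3; cases t <;> simp [Tile.HasPoint, Tile.strands]

lemma Tile.eq_arcSE (h1 : ¬ t.HasPoint .north) (h2 : ¬ t.HasPoint .west) (h3 : t.HasPoint .east) :
    t = arcSE := by
  revert h1 h2 h3; cases t <;> simp [Tile.HasPoint, Tile.strands]

lemma Tile.eq_arcEN (h1 : t.HasPoint .north) (h2 : ¬ t.HasPoint .west) (h3 : t.HasPoint .east) :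
    t = arcEN := by
  revert h1 h2 h3; cases t <;> simp [Tile.HasPoint, Tile.strands]

lemma Tile.eq_arcNW (h1 : t.HasPoint .north) (h2 : ¬ t.HasPoint .east) (h3 : t.HasPoint .west) :
    t = arcNW := by
  revert h1 h2 h3; cases t <;> simp [Tile.HasPoint, Tile.strands]

lemma Tile.not_south (h1 : ¬ t.HasPoint .north) (h2 : ¬ t.HasPoint .west)
    (h3 : ¬ t.HasPoint .east) : ¬ t.HasPoint .south := by
  revert h1 h2 h3; cases t <;> simp [Tile.HasPoint, Tile.strands]

end tiles

/-- A suitably connected `n × n` grid of tiles surrounded by blank tiles. -/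
structure IsMosaicGrid (n : ℕ) (N : ℤ → ℤ → Tile) : Prop where
  connected : GridConnected N
  box : ∀ i j, N i j ≠ .blank → 0 ≤ i ∧ i < n ∧ 0 ≤ j ∧ j < n

variable {n : ℕ}

lemma IsMosaicGrid.box_of_hasPoint (h : IsMosaicGrid n N) {i j : ℤ} {s : Side}
    (hs : (N i j).HasPoint s) : 0 ≤ i ∧ i < n ∧ 0 ≤ j ∧ j < n :=
  h.box i j fun hb => Tile.not_hasPoint_blank s (hb ▸ hs)

/-- A crossing uses all four sides, so all four neighbours lie in the mosaic. -/
lemma IsMosaicGrid.interior_of_isCrossing (h : IsMosaicGrid n N) {i j : ℤ}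
    (hc : (N i j).IsCrossing) : 0 < i ∧ i < n - 1 ∧ 0 < j ∧ j < n - 1 := by
  have h1 := h.box_of_hasPoint (h.connected i j .north (hc.hasPoint _))
  have h2 := h.box_of_hasPoint (h.connected i j .south (hc.hasPoint _))
  have h3 := h.box_of_hasPoint (h.connected i j .west (hc.hasPoint _))
  have h4 := h.box_of_hasPoint (h.connected i j .east (hc.hasPoint _))
  simp only [Side.di, Side.dj] at h1 h2 h3 h4
  omega

/-- The interior tiles of the grid are all crossing tiles. -/
def IsFull (n : ℕ) (N : ℤ → ℤ → Tile) : Prop :=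
  ∀ i j : ℤ, 0 < i → i < n - 1 → 0 < j → j < n - 1 → (N i j).IsCrossing

lemma IsMosaicGrid.not_north_top (h : IsMosaicGrid n N) (j : ℤ) : ¬ (N 0 j).HasPoint .north := by
  intro h0
  have := h.box_of_hasPoint (h.connected 0 j .north h0)
  simp [Side.di] at this

lemma IsMosaicGrid.not_west_left (h : IsMosaicGrid n N) (i : ℤ) : ¬ (N i 0).HasPoint .west := by
  intro h0
  have := h.box_of_hasPoint (h.connected i 0 .west h0)
  simp [Side.dj] at this

lemma IsMosaicGrid.not_east_right (h : IsMosaicGrid n N) (i : ℤ) :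
    ¬ (N i (n - 1)).HasPoint .east := by
  intro h0
  have := h.box_of_hasPoint (h.connected i (n - 1) .east h0)
  simp [Side.dj] at this

lemma IsMosaicGrid.south_top (h : IsMosaicGrid n N) (hf : IsFull n N) {j : ℤ} (h1 : 0 < j)
    (h2 : j < n - 1) : (N 0 j).HasPoint .south := by
  rw [h.connected.south_iff]
  exact (hf (0 + 1) j (by omega) (by omega) h1 h2).hasPoint _

lemma IsMosaicGrid.east_left (h : IsMosaicGrid n N) (hf : IsFull n N) {i : ℤ} (h1 : 0 < i)
    (h2 : i < n - 1) : (N i 0).HasPoint .east := by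
  rw [h.connected.east_iff]
  exact (hf i (0 + 1) h1 h2 (by omega) (by omega)).hasPoint _

lemma IsMosaicGrid.west_right (h : IsMosaicGrid n N) (hf : IsFull n N) {i : ℤ} (h1 : 0 < i)
    (h2 : i < n - 1) : (N i (n - 1)).HasPoint .west := by
  have := (h.connected.east_iff i (n - 2)).1 ((hf i (n - 2) h1 h2 (by omega) (by omega)).hasPoint _)
  rwa [show (n : ℤ) - 2 + 1 = n - 1 by ring] at this

/-- In a full grid the north-west corner either closes a kink or is not used. -/
lemma IsMosaicGrid.kinkCorner_or (h : IsMosaicGrid n N) (hf : IsFull n N) (hn : 4 ≤ n) :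
    KinkCorner N ∨ N 0 1 = .arcSE := by
  rcases Tile.eq_of_south _ (h.not_north_top 1) (h.south_top hf (by omega) (by omega)) with h1 | h1
  · left
    have e0 : (N 0 0).HasPoint .east := by
      rw [h.connected.east_iff]
      simp [h1, Tile.HasPoint, Tile.strands]
    have h0 := Tile.eq_arcSE _ (h.not_north_top 0) (h.not_west_left 0) e0
    refine ⟨h0, h1, Tile.eq_arcEN _ ?_ (h.not_west_left 1) (h.east_left hf (by omega) (by omega))⟩
    have := (h.connected.south_iff 0 0).1 (by simp [h0, Tile.HasPoint, Tile.strands])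
    simpa using this
  · exact Or.inr h1

/-- Away from the corners a top tile has a south point but no north point, so it is `arcWS` or
`arcSE`. An `arcSE` must be continued by an `arcWS`, and an `arcWS` offers nothing to its east, so
the two alternate. -/
lemma IsMosaicGrid.top_row (h : IsMosaicGrid n N) (hf : IsFull n N) (hn : 4 ≤ n)
    (h01 : N 0 1 = .arcSE) (k : ℕ) (hk : 2 * k + 3 < n) : N 0 (2 * k + 2) = .arcWS := by
  have step : ∀ j : ℤ, 0 < j → j < n - 2 → N 0 j = .arcSE → N 0 (j + 1) = .arcWS := by
    intro j h1 h2 hj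
    have hw := (h.connected.east_iff 0 j).1 (by simp [hj, Tile.HasPoint, Tile.strands])
    rcases Tile.eq_of_south _ (h.not_north_top (j + 1))
      (h.south_top hf (by omega) (by omega)) with h3 | h3
    · exact h3
    · simp [h3, Tile.HasPoint, Tile.strands] at hw
  induction k with
  | zero => simpa using step 1 (by omega) (by omega) h01
  | succ k ih =>
    have h1 := ih (by omega)
    have hw : ¬ (N 0 (2 * k + 2 + 1)).HasPoint .west := by
      rw [← h.connected.east_iff, h1]
      simp [Tile.HasPoint, Tile.strands]
    have h2 : N 0 (2 * k + 2 + 1) = .arcSE := by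
      rcases Tile.eq_of_south _ (h.not_north_top (2 * k + 2 + 1))
        (h.south_top hf (by omega) (by omega)) with h3 | h3
      · simp [h3, Tile.HasPoint, Tile.strands] at hw
      · exact h3
    have := step _ (by omega) (by omega) h2
    rw [← this]
    congr 1

/-- If the corner is not used, the first two inner rows of a full grid of even size close up. -/
lemma IsMosaicGrid.row_ends (h : IsMosaicGrid n N) (hf : IsFull n N) (hn : 4 ≤ n) (he : Even n)
    (h01 : N 0 1 = .arcSE) : N 1 0 = .arcSE ∧ N 2 0 = .arcEN ∧ N 1 (n - 1) = .arcWS ∧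
      N 2 (n - 1) = .arcNW := by
  have h00 : ¬ (N 0 0).HasPoint .south := by
    refine Tile.not_south _ (h.not_north_top 0) (h.not_west_left 0) ?_
    rw [h.connected.east_iff, zero_add, h01]
    simp [Tile.HasPoint, Tile.strands]
  have h10 : N 1 0 = .arcSE := by
    refine Tile.eq_arcSE _ ?_ (h.not_west_left 1) (h.east_left hf (by omega) (by omega))
    have := (h.connected.south_iff 0 0).not.1 h00
    simpa using this
  have h20 : N 2 0 = .arcEN := by
    refine Tile.eq_arcEN _ ?_ (h.not_west_left 2) (h.east_left hf (by omega) (by omega))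
    exact (h.connected.south_iff 1 0).1 (by simp [h10, Tile.HasPoint, Tile.strands])
  -- Here parity enters: `n - 2` is even, so the last top tile before the corner is `arcWS` and the
  -- north-east corner is unused.
  have h0l : N 0 (n - 2) = .arcWS := by
    obtain ⟨m, hm⟩ := he
    have := h.top_row hf hn h01 (m - 2) (by omega)
    rw [← this]
    congr 1
    omega
  have h0n : ¬ (N 0 (n - 1)).HasPoint .south := by
    refine Tile.not_south _ (h.not_north_top _) ?_ (h.not_east_right 0)
    rw [show (n : ℤ) - 1 = n - 2 + 1 by ring, ← h.connected.east_iff, h0l]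
    simp [Tile.HasPoint, Tile.strands]
  have h1n : N 1 (n - 1) = .arcWS := by
    refine Tile.eq_arcWS _ ?_ (h.not_east_right 1) (h.west_right hf (by omega) (by omega))
    have := (h.connected.south_iff 0 (n - 1)).not.1 h0n
    simpa using this
  refine ⟨h10, h20, h1n, Tile.eq_arcNW _ ?_ (h.not_east_right 2)
    (h.west_right hf (by omega) (by omega))⟩
  exact (h.connected.south_iff 1 (n - 1)).1 (by simp [h1n, Tile.HasPoint, Tile.strands])

/-- A full grid of even size whose north-west corner is not used draws more than one component. -/
lemma IsMosaicGrid.not_isPolygon (h : IsMosaicGrid n N) (hf : IsFull n N) (hn : 4 ≤ n)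
    (he : Even n) (h01 : N 0 1 = .arcSE) : ¬ IsPolygon (gridGraph N) := by
  intro hG
  obtain ⟨h10, h20, h1n, h2n⟩ := h.row_ends hf hn he h01
  -- The vertices on the axes of rows 1 and 2, together with the two points on the outer columns
  -- where these rows are joined.
  let S : Set Space := {x | x.2.1 = -4 ∨ x.2.1 = -8 ∨
    (x.2.1 = -6 ∧ (x.1 = 0 ∨ x.1 = 4 * ((n : ℝ) - 1)))}
  have hS : ∀ a b, (gridGraph N).Adj a b → a ∈ S → b ∈ S := by
    rintro a b ⟨i, j, hab⟩ ha
    have hball := hab.inBall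
    obtain ⟨a1, a2, a3⟩ := a
    obtain ⟨b1, b2, b3⟩ := b
    simp only [InBall, ctr, Prod.mk_sub_mk] at hball
    have c1 := abs_nonneg (a3 - 0)
    have c2 := abs_nonneg (a1 - 4 * j)
    have c3 := le_abs_self (a2 - -4 * i)
    have c4 := neg_abs_le (a2 - -4 * i)
    have hbox : 0 ≤ j ∧ j < n := by
      have : N i j ≠ .blank := by
        intro hb
        rw [hb] at hab
        simp [Tile.Edge, Tile.segments, Tile.strands] at hab
      exact (h.box i j this).2.2
    -- An edge leaving `S` belongs to row 1 or 2, and starts on the axis of its row unless its tile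
    -- is in an outer column.
    have hi : (i = 1 ∨ i = 2) ∧ (a2 + 4 * i = 0 ∨ j = 0 ∨ j = n - 1) := by
      rcases ha with ha | ha | ⟨ha, hx⟩ <;> simp only at ha
      · have u1 : (i : ℝ) < 2 := by linarith
        have u2 : (0 : ℝ) < i := by linarith
        have : i = 1 := by
          have : i < 2 := by exact_mod_cast u1
          have : 0 < i := by exact_mod_cast u2
          omega
        subst this
        refine ⟨Or.inl rfl, Or.inl ?_⟩
        push_cast; linarith
      · have u1 : (i : ℝ) < 3 := by linarith
        have u2 : (1 : ℝ) < i := by linarith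
        have : i = 2 := by
          have : i < 3 := by exact_mod_cast u1
          have : 1 < i := by exact_mod_cast u2
          omega
        subst this
        refine ⟨Or.inr rfl, Or.inl ?_⟩
        push_cast; linarith
      · have u1 : (i : ℝ) < 3 := by linarith
        have u2 : (0 : ℝ) < i := by linarith
        have hi : i = 1 ∨ i = 2 := by
          have : i < 3 := by exact_mod_cast u1
          have : 0 < i := by exact_mod_cast u2
          omega
        refine ⟨hi, Or.inr ?_⟩
        have hj : a1 - 4 * j = 0 := by
          rw [← abs_eq_zero]
          rcases hi with rfl | rfl <;> push_cast at * <;> linarith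
        rcases hx with hx | hx <;> simp only at hx
        · left
          have : (j : ℝ) = 0 := by linarith
          exact_mod_cast this
        · right
          have : (j : ℝ) = n - 1 := by linarith
          exact_mod_cast this
    have hends : (j = 0 ∨ j = n - 1) → (b1, b2, b3) ∈ S := by
      rintro (rfl | rfl)
      · rcases hi.1 with rfl | rfl
        · rw [h10, Tile.edge_iff_of_segments (u := Side.south.midpoint)
            (v := Side.east.midpoint) rfl] at hab
          simp only [ctr, Side.midpoint, Prod.mk_sub_mk, Prod.mk.injEq] at hab
          push_cast at hab
          rcases hab with ⟨-, f1, f2, -⟩ | ⟨-, f1, f2, -⟩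
          · left; simp only; linarith
          · right; right; exact ⟨by simp only; linarith, Or.inl (by simp only; linarith)⟩
        · rw [h20, Tile.edge_iff_of_segments (u := Side.east.midpoint)
            (v := Side.north.midpoint) rfl] at hab
          simp only [ctr, Side.midpoint, Prod.mk_sub_mk, Prod.mk.injEq] at hab
          push_cast at hab
          rcases hab with ⟨-, f1, f2, -⟩ | ⟨-, f1, f2, -⟩
          · right; right; exact ⟨by simp only; linarith, Or.inl (by simp only; linarith)⟩
          · right; left; simp only; linarith
      · rcases hi.1 with rfl | rfl
        · rw [h1n, Tile.edge_iff_of_segments (u := Side.west.midpoint)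
            (v := Side.south.midpoint) rfl] at hab
          simp only [ctr, Side.midpoint, Prod.mk_sub_mk, Prod.mk.injEq] at hab
          push_cast at hab
          rcases hab with ⟨-, f1, f2, -⟩ | ⟨-, f1, f2, -⟩
          · right; right; exact ⟨by simp only; linarith, Or.inr (by simp only; linarith)⟩
          · left; simp only; linarith
        · rw [h2n, Tile.edge_iff_of_segments (u := Side.north.midpoint)
            (v := Side.west.midpoint) rfl] at hab
          simp only [ctr, Side.midpoint, Prod.mk_sub_mk, Prod.mk.injEq] at hab
          push_cast at hab
          rcases hab with ⟨-, f1, f2, -⟩ | ⟨-, f1, f2, -⟩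
          · right; left; simp only; linarith
          · right; right; exact ⟨by simp only; linarith, Or.inr (by simp only; linarith)⟩
    by_cases hj : j = 0 ∨ j = n - 1
    · exact hends hj
    have hc := hf i j (by omega) (by omega) (by omega) (by omega)
    have ha2 : a2 + 4 * i = 0 := by tauto
    have hb2 := hc.edge_height hab (by simp only [ctr, Prod.snd_sub, Prod.fst_sub]; linarith)
    simp only [ctr, Prod.snd_sub, Prod.fst_sub] at hb2
    rcases hi.1 with rfl | rfl <;> push_cast at hb2
    · left; simp only; linarith
    · right; left; simp only; linarith
  -- The first edge starts in `S`; the second starts on the boundary between rows 0 and 1, outside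
  -- `S`.
  have hadj1 : (gridGraph N).Adj (Side.east.midpoint + ctr 1 0) (Side.south.midpoint + ctr 1 0) :=
    ⟨1, 0, by simp [h10, Tile.Edge, Tile.segments, Tile.strands]⟩
  have hadj2 : (gridGraph N).Adj (Side.south.midpoint + ctr 0 1) (Side.east.midpoint + ctr 0 1) :=
    ⟨0, 1, by simp [h01, Tile.Edge, Tile.segments, Tile.strands]⟩
  have := hG.connected S hS _ _ _ _ hadj1 hadj2 (Or.inl (by simp [Side.midpoint, ctr]))
  rcases this with h1 | h1 | ⟨h1, -⟩ <;> norm_num [Side.midpoint, ctr] at h1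

/-- The interior has `(n - 2) ^ 2` positions, and one can always be struck off: `(1, 1)` when all
are crossings, any non-crossing otherwise. -/
lemma IsMosaicGrid.exists_diagram (h : IsMosaicGrid n N) (hn : 4 ≤ n) (he : Even n)
    (hG : IsPolygon (gridGraph N)) (K : Knot) (hK : K.carrier = carrier (gridGraph N)) :
    ∃ D : Knot, K.Equivalent D ∧ D.IsDiagram ∧
      D.crossings.encard ≤ (((n - 2) ^ 2 - 1 : ℕ) : ℕ∞) := by
  let I : Finset (ℤ × ℤ) := Finset.Ioo 0 ((n : ℤ) - 1) ×ˢ Finset.Ioo 0 ((n : ℤ) - 1)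
  have hI : ∀ i j, (N i j).IsCrossing → (i, j) ∈ I := by
    intro i j hc
    have := h.interior_of_isCrossing hc
    simp [I, this]
  have hcard : ∀ p ∈ I, (I.erase p).card = (n - 2) ^ 2 - 1 := by
    intro p hp
    rw [Finset.card_erase_of_mem hp, Finset.card_product, Int.card_Ioo, sq]
    congr 2 <;> omega
  by_cases hf : IsFull n N
  · have h11 : ((1 : ℤ), (1 : ℤ)) ∈ I := by simp [I]; omega
    have hC : ∀ i j, (N i j).IsCrossing → ¬ (i = 1 ∧ j = 1) → (i, j) ∈ I.erase (1, 1) := by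
      intro i j hc hij
      rw [Finset.mem_erase]
      exact ⟨by simpa using hij, hI i j hc⟩
    rw [← hcard _ h11]
    rcases h.kinkCorner_or hf hn with hk | hk
    · rcases hf 1 1 (by omega) (by omega) (by omega) (by omega) with hc | hc
      · exact exists_diagram_of_kink_horizontal hk hc hG _ hC K hK
      · exact exists_diagram_of_kink_vertical hk hc hG _ hC K hK
    · exact absurd hG (h.not_isPolygon hf hn he hk)
  · unfold IsFull at hf
    push Not at hf
    obtain ⟨i0, j0, h1, h2, h3, h4, h5⟩ := hf
    have hmem : (i0, j0) ∈ I := by simp [I, h1, h2, h3, h4]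
    -- With a non-crossing in the interior, the knot drawn by the grid serves as its own diagram.
    refine ⟨K, Relation.EqvGen.refl K, ?_⟩
    rw [← hcard _ hmem]
    refine diagram_of_pieces (L := fun i j => (N i j).points) _ (hK.trans (carrier_gridGraph N))
      (fun i j x hx => Tile.inBall_of_mem_points hx) (fun i j => Tile.crossesOnlyAtOrigin _) ?_
    intro i j hij x hx y hy hxy
    refine Tile.eq_of_proj_eq (fun hc => hij ?_) hx hy hxy
    rw [Finset.mem_erase]
    refine ⟨?_, hI i j hc⟩
    rintro heq
    rw [Prod.mk.injEq] at heq
    obtain ⟨rfl, rfl⟩ := heq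
    exact h5 hc

/-! ### From mosaics to grids, and the conclusion -/

/-- A mosaic, extended by blank tiles to an infinite grid. -/
noncomputable def Mosaic.grid (M : Mosaic n) (i j : ℤ) : Tile :=
  if h : (0 ≤ i ∧ i < n) ∧ 0 ≤ j ∧ j < n then
    M ⟨i.toNat, by omega⟩ ⟨j.toNat, by omega⟩
  else .blank

lemma Mosaic.grid_coe (M : Mosaic n) (i j : Fin n) : M.grid (i : ℕ) (j : ℕ) = M i j := by
  have := i.2
  have := j.2
  rw [Mosaic.grid, dif_pos (by omega)]
  simp

lemma Mosaic.exists_of_grid (M : Mosaic n) {i j : ℤ} (h : M.grid i j ≠ .blank) :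
    ∃ i' j' : Fin n, i = (i' : ℕ) ∧ j = (j' : ℕ) ∧ M.grid i j = M i' j' := by
  unfold Mosaic.grid at h ⊢
  split_ifs at h ⊢ with hb
  · exact ⟨⟨i.toNat, by omega⟩, ⟨j.toNat, by omega⟩, by simp; omega, by simp; omega, rfl⟩
  · exact absurd rfl h

lemma Mosaic.isMosaicGrid {M : Mosaic n} (hM : M.SuitablyConnected) : IsMosaicGrid n M.grid where
  connected := by
    intro i j s hs
    obtain ⟨i', j', rfl, rfl, heq⟩ := M.exists_of_grid
      (fun hb => Tile.not_hasPoint_blank s (hb ▸ hs))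
    rw [heq] at hs
    obtain ⟨h1, h2, h3, h4⟩ := hM i' j'
    cases s <;> simp only [Side.di, Side.dj, Side.opp, add_zero]
    · obtain ⟨k, hk, hp⟩ := h1 hs
      rwa [show ((i' : ℕ) : ℤ) + -1 = (k : ℕ) by omega, M.grid_coe]
    · obtain ⟨k, hk, hp⟩ := h4 hs
      rwa [show ((j' : ℕ) : ℤ) + 1 = (k : ℕ) by omega, M.grid_coe]
    · obtain ⟨k, hk, hp⟩ := h2 hs
      rwa [show ((i' : ℕ) : ℤ) + 1 = (k : ℕ) by omega, M.grid_coe]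
    · obtain ⟨k, hk, hp⟩ := h3 hs
      rwa [show ((j' : ℕ) : ℤ) + -1 = (k : ℕ) by omega, M.grid_coe]
  box := by
    intro i j h
    obtain ⟨i', j', rfl, rfl, -⟩ := M.exists_of_grid h
    have := i'.2
    have := j'.2
    omega

lemma Mosaic.carrier_grid (M : Mosaic n) : carrier (gridGraph M.grid) = M.link := by
  have hc : ∀ i j : ℕ, tileCenter i j = ctr i j := fun i j => by simp [tileCenter, ctr]
  rw [carrier_gridGraph]
  ext x
  simp only [Mosaic.link, Set.mem_iUnion, Set.mem_ofPred_eq, hc, Tile.mem_points_iff]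
  have hseg : ∀ (c : Space) (p : Space × Space), x - c ∈ segment ℝ p.1 p.2 ↔
      x ∈ segment ℝ (c + p.1) (c + p.2) := fun c p => by
    rw [← sub_mem_segment (c := c) (x := x), add_sub_cancel_left, add_sub_cancel_left]
  constructor
  · rintro ⟨i, j, p, hp, hx⟩
    obtain ⟨i', j', rfl, rfl, heq⟩ := M.exists_of_grid (i := i) (j := j) (by
      intro hb
      rw [hb] at hp
      simp [Tile.segments, Tile.strands] at hp)
    rw [heq] at hp
    exact ⟨i', j', p, hp, (hseg _ _).1 hx⟩
  · rintro ⟨i, j, p, hp, hx⟩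
    exact ⟨(i : ℕ), (j : ℕ), p, by rwa [M.grid_coe], (hseg _ _).2 hx⟩

lemma IsSimpleClosedPolygon.nonempty {K : Set Space} (h : IsSimpleClosedPolygon K) :
    K.Nonempty := by
  obtain ⟨m, v, -, rfl⟩ := h
  exact ⟨v 0, Set.mem_iUnion.2 ⟨0, left_mem_segment _ _ _⟩⟩

/-- An infimum over the empty set would be `⊤`, so a finite value comes from a nonempty family,
where it is attained. -/
lemma exists_mosaic_of_mosaicNumber {K : Knot} (h : K.mosaicNumber = (n : ℕ∞)) :
    ∃ M : Mosaic n, M.Represents K := by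
  let T : Set ℕ := {n : ℕ | ∃ M : Mosaic n, M.Represents K}
  have hne : Nonempty T := by
    by_contra hT
    rw [Set.nonempty_coe_sort, Set.not_nonempty_iff_eq_empty] at hT
    have : K.mosaicNumber = ⊤ := by
      simp only [Knot.mosaicNumber]
      change ⨅ n ∈ T, (n : ℕ∞) = ⊤
      simp [hT]
    rw [this] at h
    exact ENat.top_ne_natCast _ h
  have h1 : ⨅ m : T, ((m : ℕ) : ℕ∞) = n := by
    rw [← h, Knot.mosaicNumber, iInf_subtype']
  obtain ⟨⟨m, hm⟩, hmn⟩ := ENat.exists_eq_iInf fun m : T => ((m : ℕ) : ℕ∞)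
  rw [h1] at hmn
  have : m = n := by exact_mod_cast hmn
  subst this
  exact hm

lemma crossingNumber_le (K : Knot) (hn : K.mosaicNumber = (n : ℕ∞)) (heven : Even n)
    (h3 : 3 < n) : K.crossingNumber ≤ (((n - 2) ^ 2 - 1 : ℕ) : ℕ∞) := by
  obtain ⟨M, hM, K', hK', hKK'⟩ := exists_mosaic_of_mosaicNumber hn
  have hcar : K'.carrier = carrier (gridGraph M.grid) := hK'.trans M.carrier_grid.symm
  have hgrid := Mosaic.isMosaicGrid hM
  have hG : IsPolygon (gridGraph M.grid) := by
    -- That the mosaic draws a single component enters here, through the connectedness of the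
    -- polygon `K'`.
    refine gridGraph_isPolygon hgrid.connected hgrid.box ?_ (hcar ▸ K'.isPolygon.isPreconnected)
    obtain ⟨x, hx⟩ := K'.isPolygon.nonempty
    rw [hcar] at hx
    obtain ⟨a, b, hab, -⟩ := hx
    exact ⟨a, b, hab⟩
  obtain ⟨D, hD, hdiag, hcross⟩ := hgrid.exists_diagram h3 heven hG K' hcar
  exact (iInf₂_le D ⟨hKK'.trans _ _ _ hD, hdiag⟩).trans hcross

end MosaicKnot

theorem mainTheorem4 (K : MosaicKnot.Knot) (n : ℕ) (hn : K.mosaicNumber = (n : ℕ∞))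
    (heven : Even n) (h3 : 3 < n) :
    K.crossingNumber ≤ (((n - 2) ^ 2 - 1 : ℕ) : ℕ∞) := by
  exact MosaicKnot.crossingNumber_le K hn heven h3
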